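/- Let $F$ be any field and $V$ an $F$-vector space of dimension $2m+2$ with a non-singular quadratic form $Q$, i.e. one whose polar form $f(x,y)=Q(x+y)-Q(x)-Q(y)$ is non-degenerate. For a non-singular quadratic space $(U,q)$ of finite dimension, $\mathrm{SO}(F,q)$ is the subgroup of the isometry group $\mathrm{GO}(F,q)$ given by $\det g=1$ if $\operatorname{char}F\neq 2$, and by $\dim\operatorname{Im}(1-g)$ even if $\operatorname{char}F=2$; and $\Omega(F,q)$ is the kernel of the spinor norm $\mathrm{SO}(F,q)\to F^\times/(F^\times)^2$, where the spinor norm of $g$ is the class of $x\tilde{x}$ for any invertible element $x$ of the even Clifford algebra of $q$ with $xux^{-1}=g(u)$ for all $u\in U$ ($x\mapsto\tilde x$ is the reversal anti-automorphism). Let $(v_1,v_2)$ be a hyperbolic pair in $V$, i.e. $Q(v_1)=Q(v_2)=0$ and $f(v_1,v_2)=1$; let $W=\langle v_1,v_2\rangle^{\perp}$, so that $V=\langle v_1\rangle\oplus W\oplus\langle v_2\rangle$, and let $Q_W=Q|_W$. Let $W{:}\Omega_{2m}(F,Q_W)$ denote the group of all linear maps of $V$ of the form $$v_1\mapsto v_1,\qquad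 w\mapsto Aw-f(Aw,u)\,v_1\ \ (w\in W),\qquad v_2\mapsto -Q(u)\,v_1+u+v_2,$$ with $u\in W$ and $A\in\Omega_{2m}(F,Q_W)$. **Theorem.** Suppose that $Q_W$ has Witt index at least $2$, i.e. $Q_W$ vanishes identically on some subspace of $W$ of dimension at least $2$. Then every subgroup $H$ with $$W{:}\Omega_{2m}(F,Q_W)\ \leqslant\ H\ <\ \Omega_{2m+2}(F,Q)$$ ($H$ proper in $\Omega_{2m+2}(F,Q)$) stabilises the $1$-space $\langle v_1\rangle$. -/

import Mathlib

open QuadraticMap Module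

namespace OrthogonalGroup

/-! ### Parity of the rank of `1 - g` -/

/-- The rank of an alternating bilinear form on a finite-dimensional space is even. -/
theorem alternating_even_finrank_add_ker {F : Type*} [Field F] (n : ℕ) :
    ∀ {P : Type _} [AddCommGroup P] [Module F P] [FiniteDimensional F P]
      (β : P →ₗ[F] P →ₗ[F] F), (∀ p, β p p = 0) → finrank F P = n →
      Even (finrank F P + finrank F (LinearMap.ker β)) := by
  induction n using Nat.strong_induction_on with
  | _ n ih =>
    intro P _ _ _ β hβ hn
    by_cases h0 : β = 0
    · subst h0
      rw [show LinearMap.ker (0 : P →ₗ[F] P →ₗ[F] F) = ⊤ from LinearMap.ker_zero, finrank_top]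
      exact ⟨_, rfl⟩
    · have hne : ∃ x y, β x y ≠ 0 := by
        by_contra! h
        exact h0 (LinearMap.ext fun x => LinearMap.ext fun y => by simpa using h x y)
      obtain ⟨x, y', hxy'⟩ := hne
      have halt : ∀ a b, β a b = - β b a := by
        intro a b
        have h := hβ (a + b)
        simp only [map_add, LinearMap.add_apply, hβ, zero_add, add_zero] at h
        linear_combination h
      obtain ⟨y, hxy⟩ : ∃ y, β x y = 1 := ⟨(β x y')⁻¹ • y', by simp [hxy']⟩
      have hyx : β y x = -1 := by rw [halt, hxy]
      let L : P →ₗ[F] F × F := (β x).prod (β y)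
      have hL : Function.Surjective L := by
        rintro ⟨s, t⟩
        refine ⟨s • y - t • x, ?_⟩
        simp [L, hxy, hyx, hβ]
      have hdim := L.finrank_range_add_finrank_ker
      rw [LinearMap.range_eq_top.mpr hL, finrank_top, finrank_prod, finrank_self] at hdim
      let N : Submodule F P := LinearMap.ker L
      have hN : ∀ {v}, v ∈ N ↔ β x v = 0 ∧ β y v = 0 := by
        intro v
        simp [N, L]
      let γ : N →ₗ[F] N →ₗ[F] F := β.compl₁₂ N.subtype N.subtype
      have hγ := ih (finrank F N) (by change 1 + 1 + finrank F N = _ at hdim; omega) γ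
        (fun p => hβ p) rfl
      have hker : (LinearMap.ker γ).map N.subtype = LinearMap.ker β := by
        ext v
        simp only [Submodule.mem_map, LinearMap.mem_ker, Submodule.subtype_apply]
        constructor
        · rintro ⟨v, hv, rfl⟩
          ext p
          have hp : p - β x p • y + β y p • x ∈ N := by
            rw [hN]
            simp [hxy, hyx, hβ]
          have h1 : β v (p - β x p • y + β y p • x) = 0 := by
            simpa [γ] using LinearMap.congr_fun hv ⟨_, hp⟩
          have h2 := hN.1 v.2
          simp only [map_add, map_sub, map_smul, smul_eq_mul] at h1
          rw [halt v y, halt v x, h2.1, h2.2] at h1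
          simpa using h1
        · intro hv
          refine ⟨⟨v, hN.2 ⟨?_, ?_⟩⟩, ?_, rfl⟩
          · rw [halt, hv]; simp
          · rw [halt, hv]; simp
          · ext p
            simp [γ, hv]
      rw [← hker, Submodule.finrank_map_subtype_eq]
      change 1 + 1 + finrank F N = _ at hdim
      rw [← hdim]
      have : 1 + 1 + finrank F N + finrank F (LinearMap.ker γ) =
          2 + (finrank F N + finrank F (LinearMap.ker γ)) := by ring
      rw [this]
      exact even_two.add hγ

/-- Parity of the intersections of three maximal totally singular subspaces. -/
theorem even_finrank_inf_of_totally_singular {F U : Type*} [Field F] [AddCommGroup U] [Module F U]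
    [FiniteDimensional F U] (q : QuadraticForm F U) (hq : q.polarBilin.Nondegenerate) (n : ℕ)
    (hU : finrank F U = 2 * n) (A B C : Submodule F U)
    (hA : ∀ a ∈ A, q a = 0) (hB : ∀ a ∈ B, q a = 0) (hC : ∀ a ∈ C, q a = 0)
    (dA : finrank F A = n) (dB : finrank F B = n) (dC : finrank F C = n) :
    Even (n + finrank F (A ⊓ B : Submodule F U) + finrank F (A ⊓ C : Submodule F U)
      + finrank F (B ⊓ C : Submodule F U)) := by
  let f : LinearMap.BilinForm F U := q.polarBilin
  have hf : f.Nondegenerate := hq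
  have hrefl : f.IsRefl := by
    intro x y h
    simpa [f, polar_comm] using h
  have hself : ∀ S : Submodule F U, (∀ a ∈ S, q a = 0) → finrank F S = n → f.orthogonal S = S := by
    intro S hS dS
    symm
    apply Submodule.eq_of_le_of_finrank_eq
    · intro x hx
      rw [LinearMap.BilinForm.mem_orthogonal_iff]
      intro y hy
      change polar q y x = 0
      simp [polar, hS _ (S.add_mem hy hx), hS _ hy, hS _ hx]
    · rw [LinearMap.BilinForm.finrank_orthogonal hf, hU, dS]
      omega
  have hinf : ∀ S T : Submodule F U,
      f.orthogonal (S ⊔ T) = f.orthogonal S ⊓ f.orthogonal T := by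
    intro S T
    ext x
    simp only [Submodule.mem_inf, LinearMap.BilinForm.mem_orthogonal_iff]
    refine ⟨fun h => ⟨fun y hy => h y (Submodule.mem_sup_left hy),
      fun y hy => h y (Submodule.mem_sup_right hy)⟩, ?_⟩
    rintro ⟨h1, h2⟩ y hy
    obtain ⟨s, hs, t, ht, rfl⟩ := Submodule.mem_sup.1 hy
    have e1 : f s x = 0 := h1 s hs
    have e2 : f t x = 0 := h2 t ht
    change f (s + t) x = 0
    rw [map_add, LinearMap.add_apply, e1, e2, add_zero]
  have hoo : ∀ S : Submodule F U, f.orthogonal (f.orthogonal S) = S :=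
    LinearMap.BilinForm.orthogonal_orthogonal hf hrefl
  have oA := hself A hA dA
  have oB := hself B hB dB
  have oC := hself C hC dC
  let s : A × B →ₗ[F] U := A.subtype.coprod B.subtype
  let P : Submodule F (A × B) := C.comap s
  let β : P →ₗ[F] P →ₗ[F] F :=
    f.compl₁₂ (A.subtype ∘ₗ LinearMap.fst F A B ∘ₗ P.subtype)
      (B.subtype ∘ₗ LinearMap.snd F A B ∘ₗ P.subtype)
  have hβ : ∀ p p' : P, β p p' = polar q (p.1.1 : U) (p'.1.2 : U) := fun _ _ => rfl
  have hβ0 : ∀ p, β p p = 0 := by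
    rintro ⟨⟨a, b⟩, hp⟩
    rw [hβ]
    have : q ((a : U) + b) = 0 := hC _ (by simpa [P, s] using hp)
    simp [polar, this, hA a a.2, hB b b.2]
  have key := alternating_even_finrank_add_ker _ β hβ0 rfl
  have e1 := (A ⊓ B).finrank_sup_add_finrank_inf_eq C
  have dP : finrank F P = n + finrank F (A ⊓ B ⊓ C : Submodule F U) := by
    have h1 := (s ∘ₗ P.subtype).finrank_range_add_finrank_ker
    have hr : LinearMap.range (s ∘ₗ P.subtype) = (A ⊔ B) ⊓ C := by
      rw [LinearMap.range_comp, Submodule.range_subtype, Submodule.map_comap_eq]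
      congr 1
      rw [LinearMap.range_coprod]
      simp
    have hk : finrank F (LinearMap.ker (s ∘ₗ P.subtype)) = finrank F (A ⊓ B : Submodule F U) := by
      let φ : (A ⊓ B : Submodule F U) →ₗ[F] P :=
        { toFun := fun d => ⟨(⟨d, d.2.1⟩, ⟨-d, B.neg_mem d.2.2⟩), by simp [P, s]⟩
          map_add' := fun d d' => Subtype.ext (Prod.ext rfl (Subtype.ext (neg_add (d : U) d')))
          map_smul' := fun c d =>
            Subtype.ext (Prod.ext rfl (Subtype.ext (smul_neg c (d : U)).symm)) }
      have hφ : Function.Injective φ := by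
        intro d d' h
        have := congrArg (fun p : P => (p.1.1 : U)) h
        exact Subtype.ext this
      have : LinearMap.range φ = LinearMap.ker (s ∘ₗ P.subtype) := by
        ext p
        constructor
        · rintro ⟨d, rfl⟩
          simp [φ, s]
        · intro h
          obtain ⟨⟨a, b⟩, hp⟩ := p
          have hab : (a : U) + b = 0 := by simpa [s] using h
          have hab' : (b : U) = -a := by rw [eq_neg_iff_add_eq_zero, add_comm]; exact hab
          refine ⟨⟨a, a.2, ?_⟩, ?_⟩
          · have := B.neg_mem b.2
            rwa [hab', neg_neg] at this
          · ext
            · rfl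
            · exact hab'.symm
      rw [← this, LinearMap.finrank_range_of_inj hφ]
    have ho : (A ⊔ B) ⊓ C = f.orthogonal ((A ⊓ B) ⊔ C) := by
      rw [hinf, oC]
      congr 1
      rw [← hoo (A ⊔ B), hinf, oA, oB]
    have h2 := LinearMap.BilinForm.finrank_orthogonal hf ((A ⊓ B) ⊔ C)
    rw [hr, hk, ho, h2] at h1
    have h3 := Submodule.finrank_le ((A ⊓ B) ⊔ C)
    have h4 := Submodule.finrank_mono (inf_le_left : A ⊓ B ≤ A)
    omega
  have dK : finrank F (LinearMap.ker β) + finrank F (A ⊓ B ⊓ C : Submodule F U) =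
      finrank F (A ⊓ B : Submodule F U) + finrank F (A ⊓ C : Submodule F U)
        + finrank F (B ⊓ C : Submodule F U) := by
    let ψ : ((A ⊓ C : Submodule F U) × (B ⊓ C : Submodule F U)) × (A ⊓ B : Submodule F U)
        →ₗ[F] P :=
      { toFun := fun d => ⟨(⟨d.1.1 + d.2, A.add_mem d.1.1.2.1 d.2.2.1⟩,
            ⟨d.1.2 - d.2, B.sub_mem d.1.2.2.1 d.2.2.2⟩), by
            have := C.add_mem d.1.1.2.2 d.1.2.2.2
            simpa [P, s] using this⟩
        map_add' := fun d d' => Subtype.ext (Prod.ext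
          (Subtype.ext (add_add_add_comm (d.1.1 : U) d'.1.1 d.2 d'.2))
          (Subtype.ext (add_sub_add_comm (d.1.2 : U) d'.1.2 d.2 d'.2)))
        map_smul' := fun c d => Subtype.ext (Prod.ext
          (Subtype.ext (smul_add c (d.1.1 : U) d.2).symm)
          (Subtype.ext (smul_sub c (d.1.2 : U) d.2).symm)) }
    have hr : LinearMap.range ψ = LinearMap.ker β := by
      ext p
      constructor
      · rintro ⟨⟨⟨a, b⟩, d⟩, rfl⟩
        rw [LinearMap.mem_ker]
        ext ⟨⟨a', b'⟩, hp⟩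
        have hp' : (a' : U) + b' ∈ C := by simpa [P, s] using hp
        change f ((a : U) + d) b' = 0
        have z1 : f (a : U) ((a' : U) + b') = 0 := by
          have : (a : U) ∈ f.orthogonal C := by rw [oC]; exact a.2.2
          exact hrefl _ _ (LinearMap.BilinForm.mem_orthogonal_iff.1 this _ hp')
        have z2 : f (a : U) (a' : U) = 0 := by
          have : (a : U) ∈ f.orthogonal A := by rw [oA]; exact a.2.1
          exact hrefl _ _ (LinearMap.BilinForm.mem_orthogonal_iff.1 this _ a'.2)
        have z3 : f (d : U) (b' : U) = 0 := by
          have : (d : U) ∈ f.orthogonal B := by rw [oB]; exact d.2.2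
          exact hrefl _ _ (LinearMap.BilinForm.mem_orthogonal_iff.1 this _ b'.2)
        rw [map_add, z2, zero_add] at z1
        rw [map_add, LinearMap.add_apply, z1, z3, add_zero]
      · intro h
        obtain ⟨⟨a, b⟩, hp⟩ := p
        have hp' : (a : U) + b ∈ C := by simpa [P, s] using hp
        have ha : (a : U) ∈ B ⊔ (A ⊓ C) := by
          have : B ⊔ (A ⊓ C) = f.orthogonal (B ⊓ (A ⊔ C)) := by
            rw [← hoo (B ⊔ (A ⊓ C)), hinf, oB]
            congr 2
            rw [← hoo (A ⊔ C), hinf, oA, oC]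
          rw [this, LinearMap.BilinForm.mem_orthogonal_iff]
          rintro b' ⟨hb', hs⟩
          obtain ⟨a', ha', c, hc, hac⟩ := Submodule.mem_sup.1 hs
          have := LinearMap.congr_fun h (⟨(⟨-a', A.neg_mem ha'⟩, ⟨b', hb'⟩), by
            simpa [P, s, ← hac] using hc⟩ : P)
          exact hrefl _ _ this
        obtain ⟨d, hd, a1, ha1, hda⟩ := Submodule.mem_sup.1 ha
        have hdA : d ∈ A := by
          have : d = a - a1 := by rw [← hda]; abel
          rw [this]
          exact A.sub_mem a.2 ha1.1
        refine ⟨((⟨a1, ha1⟩, ⟨b + d, B.add_mem b.2 hd, ?_⟩), ⟨d, hdA, hd⟩), ?_⟩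
        · have : (b : U) + d = (a + b) - a1 := by rw [← hda]; abel
          rw [this]
          exact C.sub_mem hp' ha1.2
        · ext
          · change a1 + d = a
            rw [← hda, add_comm]
          · change (b : U) + d - d = b
            abel
    have hk : finrank F (LinearMap.ker ψ) = finrank F (A ⊓ B ⊓ C : Submodule F U) := by
      let φ : (A ⊓ B ⊓ C : Submodule F U) →ₗ[F]
          ((A ⊓ C : Submodule F U) × (B ⊓ C : Submodule F U)) × (A ⊓ B : Submodule F U) :=
        { toFun := fun d => ((⟨-d, A.neg_mem d.2.1.1, C.neg_mem d.2.2⟩, ⟨d, d.2.1.2, d.2.2⟩),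
            ⟨d, d.2.1⟩)
          map_add' := fun d d' =>
            Prod.ext (Prod.ext (Subtype.ext (neg_add (d : U) d')) rfl) rfl
          map_smul' := fun c d =>
            Prod.ext (Prod.ext (Subtype.ext (smul_neg c (d : U)).symm) rfl) rfl }
      have hφ : Function.Injective φ := by
        intro d d' h
        have := congrArg (fun p => (p.2 : U)) h
        exact Subtype.ext this
      have : LinearMap.range φ = LinearMap.ker ψ := by
        ext p
        constructor
        · rintro ⟨d, rfl⟩
          rw [LinearMap.mem_ker]
          ext
          · change -(d : U) + d = 0
            abel
          · change (d : U) - d = 0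
            abel
        · intro h
          obtain ⟨⟨a, b⟩, d⟩ := p
          have h1 : (a : U) + d = 0 := congrArg (fun p : P => (p.1.1 : U)) h
          have h2 : (b : U) - d = 0 := congrArg (fun p : P => (p.1.2 : U)) h
          have h1' : (a : U) = -d := eq_neg_of_add_eq_zero_left h1
          have h2' : (b : U) = d := sub_eq_zero.1 h2
          refine ⟨⟨d, d.2, h2' ▸ b.2.2⟩, ?_⟩
          ext
          · exact h1'.symm
          · exact h2'.symm
          · rfl
      rw [← this, LinearMap.finrank_range_of_inj hφ]
    have h1 := ψ.finrank_range_add_finrank_ker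
    rw [hr, hk, finrank_prod, finrank_prod] at h1
    omega
  have : finrank F P + finrank F (LinearMap.ker β) =
      n + finrank F (A ⊓ B : Submodule F U) + finrank F (A ⊓ C : Submodule F U)
      + finrank F (B ⊓ C : Submodule F U) := by omega
  rwa [this] at key

/-! ### The groups `GO`, `SO` and `Ω` -/

section Groups

variable {F V : Type*} [Field F] [AddCommGroup V] [Module F V]

/-- The general orthogonal group `GO(F, Q)`. -/
def GO (Q : QuadraticForm F V) : Subgroup (V ≃ₗ[F] V) where
  carrier := {g | ∀ v, Q (g v) = Q v}
  one_mem' := fun _ => rfl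
  mul_mem' := fun {g h} hg hh v => by
    rw [LinearEquiv.mul_apply, hg, hh]
  inv_mem' := fun {g} hg v => by
    have h := hg (g⁻¹ v)
    rw [← LinearEquiv.mul_apply, mul_inv_cancel] at h
    exact h.symm

/-- The quasideterminant `g ↦ dim Im (1 - g) mod 2`. -/
noncomputable def qdet (g : V ≃ₗ[F] V) : ZMod 2 :=
  (finrank F (LinearMap.range (LinearMap.id - (g : V →ₗ[F] V))) : ZMod 2)

/-- The quadratic form `Q` is non-singular: its polar form is nondegenerate. -/
def Nonsingular (Q : QuadraticForm F V) : Prop := Q.polarBilin.Nondegenerate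

theorem nonsingular_iff (Q : QuadraticForm F V) :
    Nonsingular Q ↔ ∀ x, (∀ y, polar Q x y = 0) → x = 0 := by
  have hr : Q.polarBilin.IsRefl := fun x y h => by simpa [polar_comm] using h
  unfold Nonsingular
  rw [hr.nondegenerate_iff_separatingLeft]
  rfl

theorem qdet_one : qdet (1 : V ≃ₗ[F] V) = 0 := by
  have : LinearMap.id - ((1 : V ≃ₗ[F] V) : V →ₗ[F] V) = 0 := by
    ext v
    simp
  rw [qdet, this, LinearMap.range_zero, finrank_bot, Nat.cast_zero]

theorem qdet_mul [FiniteDimensional F V] (Q : QuadraticForm F V) (hQ : Nonsingular Q)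
    {g h : V ≃ₗ[F] V} (hg : g ∈ GO Q) (hh : h ∈ GO Q) : qdet (g * h) = qdet g + qdet h := by
  let q : QuadraticForm F (V × V) := Q.prod (-Q)
  have hqa : ∀ p, q p = Q p.1 - Q p.2 := fun p => (sub_eq_add_neg _ _).symm
  have hpol : ∀ p p', polar q p p' = polar Q p.1 p'.1 - polar Q p.2 p'.2 := by
    intro p p'
    simp only [polar, hqa, Prod.fst_add, Prod.snd_add]
    ring
  have hq : q.polarBilin.Nondegenerate := by
    refine (nonsingular_iff q).2 ?_
    rintro ⟨x, y⟩ hxy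
    ext
    · refine (nonsingular_iff Q).1 hQ _ fun z => ?_
      simpa [hpol] using hxy (z, 0)
    · refine (nonsingular_iff Q).1 hQ _ fun z => ?_
      simpa [hpol] using hxy (0, z)
  let Γ : (V ≃ₗ[F] V) → Submodule F (V × V) := fun k =>
    LinearMap.range (LinearMap.id.prod (k : V →ₗ[F] V))
  have hΓ : ∀ k p, p ∈ Γ k ↔ k p.1 = p.2 := by
    intro k p
    constructor
    · rintro ⟨x, rfl⟩
      rfl
    · intro h
      exact ⟨p.1, Prod.ext rfl h⟩
  have hs : ∀ k ∈ GO Q, ∀ p ∈ Γ k, q p = 0 := by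
    intro k hk p hp
    rw [hqa, ← (hΓ k p).1 hp, hk, sub_self]
  have hd : ∀ k, finrank F (Γ k) = finrank F V := fun k =>
    LinearMap.finrank_range_of_inj fun x y hxy => congrArg Prod.fst hxy
  have hi : ∀ k l : V ≃ₗ[F] V, finrank F (Γ k ⊓ Γ l : Submodule F (V × V)) =
      finrank F (LinearMap.ker ((k : V →ₗ[F] V) - (l : V →ₗ[F] V))) := by
    intro k l
    have : Γ k ⊓ Γ l = (LinearMap.ker ((k : V →ₗ[F] V) - (l : V →ₗ[F] V))).map
        (LinearMap.id.prod (k : V →ₗ[F] V)) := by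
      ext p
      rw [Submodule.mem_inf, hΓ, hΓ]
      constructor
      · rintro ⟨h1, h2⟩
        refine ⟨p.1, ?_, Prod.ext rfl h1⟩
        simp [h1, h2]
      · rintro ⟨x, hx, rfl⟩
        have hx' : k x - l x = 0 := hx
        exact ⟨rfl, (sub_eq_zero.1 hx').symm⟩
    rw [this]
    exact LinearEquiv.finrank_eq (Submodule.equivMapOfInjective _
      (fun x y hxy => congrArg Prod.fst hxy) _).symm
  have key := even_finrank_inf_of_totally_singular q hq (finrank F V)
    (by rw [finrank_prod]; ring) (Γ 1) (Γ g) (Γ (g * h)) (hs 1 (GO Q).one_mem) (hs g hg)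
    (hs _ ((GO Q).mul_mem hg hh)) (hd _) (hd _) (hd _)
  rw [hi, hi, hi] at key
  have hk : LinearMap.ker ((g : V →ₗ[F] V) - ((g * h : V ≃ₗ[F] V) : V →ₗ[F] V)) =
      LinearMap.ker (LinearMap.id - (h : V →ₗ[F] V)) := by
    ext v
    simp [sub_eq_zero]
  rw [hk] at key
  let r : (V ≃ₗ[F] V) → ℕ := fun k => finrank F (LinearMap.range (LinearMap.id - (k : V →ₗ[F] V)))
  let n : (V ≃ₗ[F] V) → ℕ := fun k => finrank F (LinearMap.ker (LinearMap.id - (k : V →ₗ[F] V)))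
  have hrn : ∀ k, r k + n k = finrank F V := fun k =>
    (LinearMap.id - (k : V →ₗ[F] V)).finrank_range_add_finrank_ker
  have key' : Even (finrank F V + n g + n (g * h) + n h) := key
  have e1 := hrn g
  have e2 := hrn h
  have e3 := hrn (g * h)
  change ((r (g * h) : ℕ) : ZMod 2) = (r g : ZMod 2) + (r h : ZMod 2)
  rw [← Nat.cast_add, ZMod.natCast_eq_natCast_iff]
  rw [Nat.even_iff] at key'
  unfold Nat.ModEq
  generalize r (g * h) = a1 at *
  generalize r g = a2 at *
  generalize r h = a3 at *
  generalize n (g * h) = a4 at *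
  generalize n g = a5 at *
  generalize n h = a6 at *
  omega

/-- The special orthogonal group `SO(F, Q)`: the kernel on `GO(F, Q)` of the determinant if
`char F ≠ 2`, and of the quasideterminant if `char F = 2`. -/
noncomputable def SO [FiniteDimensional F V] (Q : QuadraticForm F V) (hQ : Nonsingular Q) :
    Subgroup (V ≃ₗ[F] V) where
  carrier := {g | g ∈ GO Q ∧ (ringChar F ≠ 2 → LinearEquiv.det g = 1) ∧
    (ringChar F = 2 → qdet g = 0)}
  one_mem' := ⟨(GO Q).one_mem, fun _ => map_one _, fun _ => qdet_one⟩
  mul_mem' := fun {g h} hg hh => ⟨(GO Q).mul_mem hg.1 hh.1,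
    fun hc => by rw [map_mul, hg.2.1 hc, hh.2.1 hc, one_mul],
    fun hc => by rw [qdet_mul Q hQ hg.1 hh.1, hg.2.2 hc, hh.2.2 hc, add_zero]⟩
  inv_mem' := fun {g} hg => ⟨(GO Q).inv_mem hg.1,
    fun hc => by rw [map_inv, hg.2.1 hc, inv_one],
    fun hc => by
      have h := qdet_mul Q hQ hg.1 ((GO Q).inv_mem hg.1)
      rw [mul_inv_cancel, qdet_one, hg.2.2 hc, zero_add] at h
      exact h.symm⟩

/-- `c` represents the spinor norm of `g`: there is an element `x` of the even Clifford group, acting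
on `V` by conjugation as `g`, whose norm `x * reverse x` is `c`. For non-singular `Q` such an `x`
exists for every `g` in `SO(F, Q)` and is unique up to a nonzero scalar, so that the spinor
norm of `g` is the class of `c` in `Fˣ / (Fˣ)²`. -/
def IsSpinorNorm (Q : QuadraticForm F V) (g : V ≃ₗ[F] V) (c : Fˣ) : Prop :=
  ∃ x ∈ CliffordAlgebra.even Q,
    x * CliffordAlgebra.reverse x = algebraMap F (CliffordAlgebra Q) c ∧
    CliffordAlgebra.reverse x * x = algebraMap F (CliffordAlgebra Q) c ∧
    ∀ v, x * CliffordAlgebra.ι Q v = CliffordAlgebra.ι Q (g v) * x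

theorem IsSpinorNorm.one (Q : QuadraticForm F V) : IsSpinorNorm Q 1 1 :=
  ⟨1, Subalgebra.one_mem _, by simp, by simp, fun v => by simp⟩

theorem IsSpinorNorm.mul {Q : QuadraticForm F V} {g h : V ≃ₗ[F] V} {c d : Fˣ}
    (hg : IsSpinorNorm Q g c) (hh : IsSpinorNorm Q h d) : IsSpinorNorm Q (g * h) (c * d) := by
  obtain ⟨x, hx, hx1, hx2, hx3⟩ := hg
  obtain ⟨y, hy, hy1, hy2, hy3⟩ := hh
  refine ⟨x * y, Subalgebra.mul_mem _ hx hy, ?_, ?_, fun v => ?_⟩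
  · rw [CliffordAlgebra.reverse.map_mul, mul_assoc, ← mul_assoc y, hy1, Algebra.commutes,
      ← mul_assoc, hx1, Units.val_mul, map_mul]
  · rw [CliffordAlgebra.reverse.map_mul, mul_assoc, ← mul_assoc _ x, hx2, Algebra.commutes,
      ← mul_assoc, hy2, Units.val_mul, mul_comm, map_mul]
  · rw [mul_assoc, hy3, ← mul_assoc, hx3, mul_assoc, LinearEquiv.mul_apply]

theorem IsSpinorNorm.inv {Q : QuadraticForm F V} {g : V ≃ₗ[F] V} {c : Fˣ}
    (hg : IsSpinorNorm Q g c) : IsSpinorNorm Q g⁻¹ c := by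
  obtain ⟨x, hx, hx1, hx2, hx3⟩ := hg
  refine ⟨CliffordAlgebra.reverse x, ?_, ?_, ?_, fun v => ?_⟩
  · exact (CliffordAlgebra.reverse_mem_evenOdd_iff Q).2 hx
  · rw [CliffordAlgebra.reverse_reverse, hx2]
  · rw [CliffordAlgebra.reverse_reverse, hx1]
  · have h := congrArg CliffordAlgebra.reverse (hx3 (g⁻¹ v))
    rw [← LinearEquiv.mul_apply, mul_inv_cancel, CliffordAlgebra.reverse.map_mul,
      CliffordAlgebra.reverse.map_mul, CliffordAlgebra.reverse_ι,
      CliffordAlgebra.reverse_ι] at h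
    exact h.symm

/-- The group `Ω(F, Q)`: the kernel of the spinor norm `SO(F, Q) → Fˣ / (Fˣ)²`. -/
noncomputable def Omega [FiniteDimensional F V] (Q : QuadraticForm F V) (hQ : Nonsingular Q) :
    Subgroup (V ≃ₗ[F] V) where
  carrier := {g | g ∈ SO Q hQ ∧ ∃ c : Fˣ, IsSpinorNorm Q g c ∧ IsSquare c}
  one_mem' := ⟨(SO Q hQ).one_mem, 1, .one Q, .one⟩
  mul_mem' := fun {_ _} ⟨hg, c, hc, hc'⟩ ⟨hh, d, hd, hd'⟩ =>
    ⟨(SO Q hQ).mul_mem hg hh, c * d, hc.mul hd, hc'.mul hd'⟩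
  inv_mem' := fun {_} ⟨hg, c, hc, hc'⟩ => ⟨(SO Q hQ).inv_mem hg, c, hc.inv, hc'⟩

/-- The Witt index of `Q`: the largest dimension of a subspace on which `Q` vanishes. -/
noncomputable def wittIndex (Q : QuadraticForm F V) : ℕ :=
  sSup {d | ∃ U : Submodule F V, (∀ u ∈ U, Q u = 0) ∧ finrank F U = d}

/-! ### Hyperbolic pairs and the subgroup `W : Ω(F, Q_W)` -/

/-- `(v₁, v₂)` is a hyperbolic pair. -/
structure IsHyperbolicPair (Q : QuadraticForm F V) (v₁ v₂ : V) : Prop where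
  left : Q v₁ = 0
  right : Q v₂ = 0
  polar_eq_one : polar Q v₁ v₂ = 1

/-- The subspace `W = ⟨v₁, v₂⟩^⊥`. -/
def perp (Q : QuadraticForm F V) (v₁ v₂ : V) : Submodule F V :=
  LinearMap.ker (Q.polarBilin v₁) ⊓ LinearMap.ker (Q.polarBilin v₂)

/-- The restriction `Q_W` of `Q` to `W = ⟨v₁, v₂⟩^⊥`. -/
def restr (Q : QuadraticForm F V) (v₁ v₂ : V) : QuadraticForm F (perp Q v₁ v₂) :=
  Q.comp (perp Q v₁ v₂).subtype

theorem mem_perp {Q : QuadraticForm F V} {v₁ v₂ w : V} :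
    w ∈ perp Q v₁ v₂ ↔ polar Q v₁ w = 0 ∧ polar Q v₂ w = 0 := Iff.rfl

theorem IsHyperbolicPair.decomp {Q : QuadraticForm F V} {v₁ v₂ : V}
    (h : IsHyperbolicPair Q v₁ v₂) (v : V) :
    v - polar Q v₂ v • v₁ - polar Q v₁ v • v₂ ∈ perp Q v₁ v₂ := by
  have h1 : polar Q v₁ v₁ = 0 := by rw [polar_self, h.left, smul_zero]
  have h2 : polar Q v₂ v₂ = 0 := by rw [polar_self, h.right, smul_zero]
  have h3 : polar Q v₂ v₁ = 1 := by rw [polar_comm, h.polar_eq_one]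
  rw [mem_perp]
  simp [polar_sub_right, polar_smul_right, h1, h2, h3, h.polar_eq_one]

theorem IsHyperbolicPair.nonsingular_restr {Q : QuadraticForm F V} {v₁ v₂ : V}
    (h : IsHyperbolicPair Q v₁ v₂) (hQ : Nonsingular Q) : Nonsingular (restr Q v₁ v₂) := by
  rw [nonsingular_iff] at hQ ⊢
  intro x hx
  refine Subtype.ext (hQ _ fun y => ?_)
  have hy : polar Q (x : V) (y - polar Q v₂ y • v₁ - polar Q v₁ y • v₂) = 0 := hx ⟨_, h.decomp y⟩
  have hx' := mem_perp.1 x.2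
  rw [polar_comm Q v₁, polar_comm Q v₂] at hx'
  simpa [polar_sub_right, polar_smul_right, hx'.1, hx'.2] using hy

/-- The subgroup `W : Ω(F, Q_W)` of `Ω(F, Q)` determined by the hyperbolic pair `(v₁, v₂)`. With
respect to `V = ⟨v₁⟩ ⊕ W ⊕ ⟨v₂⟩` it consists of the linear maps
`v₁ ↦ v₁`, `w ↦ A w - f (A w, u) v₁`, `v₂ ↦ - Q(u) v₁ + u + v₂`,
where `u ∈ W` and `A ∈ Ω(F, Q_W)`; here `f` is the polar form. -/
noncomputable def WOmega [FiniteDimensional F V] (Q : QuadraticForm F V) (hQ : Nonsingular Q)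
    {v₁ v₂ : V} (h : IsHyperbolicPair Q v₁ v₂) : Subgroup (V ≃ₗ[F] V) where
  carrier := {g | ∃ A ∈ Omega (restr Q v₁ v₂) (h.nonsingular_restr hQ), ∃ u : perp Q v₁ v₂,
    g v₁ = v₁ ∧ (∀ w : perp Q v₁ v₂, g w = (A w : V) - polar Q (A w : V) u • v₁) ∧
    g v₂ = - (Q u • v₁) + u + v₂}
  one_mem' := ⟨1, Subgroup.one_mem _, 0, rfl, fun w => by simp, by simp⟩
  mul_mem' := by
    rintro g g' ⟨A, hA, u, h1, h2, h3⟩ ⟨A', hA', u', h1', h2', h3'⟩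
    have hf : ∀ x y, polar Q (A x : V) (A y : V) = polar Q (x : V) (y : V) := by
      intro x y
      have e : ∀ z, Q (A z : V) = Q (z : V) := hA.1.1
      have e3 : Q ((A x : V) + A y) = Q ((x : V) + y) := by
        have := e (x + y)
        rwa [map_add] at this
      simp only [polar, e3, e]
    have hq : Q (A u' : V) = Q (u' : V) := hA.1.1 u'
    refine ⟨A * A', Subgroup.mul_mem _ hA hA', u + A u', ?_, fun w => ?_, ?_⟩
    · rw [LinearEquiv.mul_apply, h1', h1]
    · rw [LinearEquiv.mul_apply, h2', map_sub, map_smul, h1, h2, LinearEquiv.mul_apply,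
        Submodule.coe_add, polar_add_right, hf]
      module
    · rw [LinearEquiv.mul_apply, h3', map_add, map_add, map_neg, map_smul, h1, h2, h3,
        Submodule.coe_add, QuadraticMap.map_add Q, hq, polar_comm Q (u : V)]
      module
  inv_mem' := by
    rintro g ⟨A, hA, u, h1, h2, h3⟩
    have hAA : ∀ w, A (A⁻¹ w) = w := fun w => by
      rw [← LinearEquiv.mul_apply, mul_inv_cancel, LinearEquiv.coe_one, id]
    have e : ∀ z, Q (A z : V) = Q (z : V) := hA.1.1
    have hf : ∀ x y, polar Q (A x : V) (A y : V) = polar Q (x : V) (y : V) := by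
      intro x y
      have e3 : Q ((A x : V) + A y) = Q ((x : V) + y) := by
        have := e (x + y)
        rwa [map_add] at this
      simp only [polar, e3, e]
    have hinv : ∀ x y, g y = x → g⁻¹ x = y := by
      rintro _ y rfl
      rw [← LinearEquiv.mul_apply, inv_mul_cancel, LinearEquiv.coe_one, id]
    refine ⟨A⁻¹, Subgroup.inv_mem _ hA, -A⁻¹ u, hinv _ _ h1, fun w => hinv _ _ ?_, hinv _ _ ?_⟩
    · rw [map_sub, map_smul, h1, h2, hAA, Submodule.coe_neg, polar_neg_right,
        ← hf (A⁻¹ w), hAA, hAA]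
      module
    · have hq : Q ((A⁻¹ u : perp Q v₁ v₂) : V) = Q (u : V) := by rw [← e, hAA]
      rw [Submodule.coe_neg, QuadraticMap.map_neg, hq, map_add, map_add, map_neg, map_neg, map_smul,
        h1, h2, h3, hAA, polar_self]
      module

end Groups

end OrthogonalGroup

/-! Write `f` for the polar form. The subgroup `WOmega` contains the whole stabiliser of the vector
`v₁` in `Omega` (`IsHyperbolicPair.mem_WOmega_of_fixes`), so `H` does too. Suppose `H` moves the
point `⟨v₁⟩`; the claim is that then `H` contains `Omega` (`IsHyperbolicPair.Omega_le`), against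
properness.

The main tool is the Siegel transformation centred at a singular vector `x`. It lies in `Omega`, it
fixes `x`, and it carries any singular `a` to any singular `b` provided `f(x,a) = f(x,b) = 1`. Those
with centre `v₁` join all singular points not orthogonal to `v₁`. Those with singular centre in `W`
join all singular points orthogonal to `v₁` and different from `⟨v₁⟩`; here `dim W > 2`, a
consequence of the Witt index hypothesis, is needed. An `H`-orbit that moves `⟨v₁⟩` meets both
families, hence `H` is transitive on singular points.

Conjugation then puts every Siegel transformation with nonzero centre into `H`. These can rescale
`v₁` arbitrarily, so `H` is transitive on nonzero singular vectors; as it contains a vector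
stabiliser, it contains `Omega`.

The stabiliser statement reduces, modulo a Siegel transformation, to an isometry fixing `v₁` and
`v₂`. Its restriction to `W` must have square spinor norm, which follows from representing the
Clifford algebra of `V` by `2 × 2` matrices over that of `W` (`IsSpinorNorm.restrict`). -/

namespace OrthogonalGroup

/-! ### Clifford algebras and spinor norms under splitting off a hyperbolic plane. -/

section CliffordRestriction

variable {F V : Type*} [Field F] [AddCommGroup V] [Module F V] {Q : QuadraticForm F V} {v₁ v₂ : V}

/-- The orthogonal projection of `V` onto `⟨v₁, v₂⟩^⊥`. -/
noncomputable def IsHyperbolicPair.proj (h : IsHyperbolicPair Q v₁ v₂) : V →ₗ[F] perp Q v₁ v₂ where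
  toFun v := ⟨_, h.decomp v⟩
  map_add' v w := by
    ext
    simp only [polar_add_right, Submodule.coe_add]
    module
  map_smul' c v := by
    ext
    simp only [polar_smul_right, smul_eq_mul, RingHom.id_apply, Submodule.coe_smul]
    module

theorem IsHyperbolicPair.coe_proj (h : IsHyperbolicPair Q v₁ v₂) (v : V) :
    (h.proj v : V) = v - polar Q v₂ v • v₁ - polar Q v₁ v • v₂ := rfl

theorem IsHyperbolicPair.polar_left_self (h : IsHyperbolicPair Q v₁ v₂) : polar Q v₁ v₁ = 0 := by
  rw [polar_self, h.left, smul_zero]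

theorem IsHyperbolicPair.polar_right_self (h : IsHyperbolicPair Q v₁ v₂) : polar Q v₂ v₂ = 0 := by
  rw [polar_self, h.right, smul_zero]

theorem IsHyperbolicPair.polar_swap (h : IsHyperbolicPair Q v₁ v₂) : polar Q v₂ v₁ = 1 := by
  rw [polar_comm, h.polar_eq_one]

theorem IsHyperbolicPair.eq_add (h : IsHyperbolicPair Q v₁ v₂) (v : V) :
    v = polar Q v₂ v • v₁ + h.proj v + polar Q v₁ v • v₂ := by
  rw [h.coe_proj]
  module

theorem IsHyperbolicPair.map_eq (h : IsHyperbolicPair Q v₁ v₂) (v : V) :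
    Q v = Q (h.proj v : V) + polar Q v₂ v * polar Q v₁ v := by
  have hw := mem_perp.1 (h.proj v).2
  conv_lhs => rw [h.eq_add v]
  simp [QuadraticMap.map_add Q, QuadraticMap.map_smul, h.left, h.right, polar_add_left,
    polar_smul_left, polar_smul_right, hw.1, h.polar_eq_one, polar_comm Q (h.proj v : V) v₂, hw.2]
  ring

theorem IsHyperbolicPair.proj_coe (h : IsHyperbolicPair Q v₁ v₂) (w : perp Q v₁ v₂) :
    h.proj w = w := by
  have hw := mem_perp.1 w.2
  ext
  rw [h.coe_proj, hw.1, hw.2]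
  simp

theorem IsHyperbolicPair.proj_left (h : IsHyperbolicPair Q v₁ v₂) : h.proj v₁ = 0 := by
  ext
  rw [h.coe_proj, h.polar_left_self, h.polar_swap]
  simp

theorem IsHyperbolicPair.proj_right (h : IsHyperbolicPair Q v₁ v₂) : h.proj v₂ = 0 := by
  ext
  rw [h.coe_proj, h.polar_right_self, h.polar_eq_one]
  simp

/-- This is the Clifford relation for `r v₁ + w + s v₂`, whose form value is `Q(w) + r s`. The
off-diagonal entries cancel because scalars are central. -/
theorem matrix_mul_self_eq_algebraMap {A : Type*} [Ring A] [Algebra F A] {a : A} {q : F}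
    (ha : a * a = algebraMap F A q) (r s : F) :
    !![a, algebraMap F A r; algebraMap F A s, -a] * !![a, algebraMap F A r; algebraMap F A s, -a] =
      algebraMap F (Matrix (Fin 2) (Fin 2) A) (q + r * s) := by
  have e : algebraMap F A (q + r * s) = a * a + algebraMap F A r * algebraMap F A s := by
    rw [ha, map_add, map_mul]
  have e' : algebraMap F A (q + r * s) = algebraMap F A s * algebraMap F A r + -a * -a := by
    rw [neg_mul_neg, ha, map_add, ← map_mul, mul_comm, add_comm]
  rw [Matrix.mul_fin_two]
  refine Matrix.ext (Fin.forall_fin_two.2 ⟨Fin.forall_fin_two.2 ⟨?_, ?_⟩,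
    Fin.forall_fin_two.2 ⟨?_, ?_⟩⟩)
  · exact e.symm
  · change a * algebraMap F A r + algebraMap F A r * -a = 0
    rw [mul_neg, Algebra.commutes, add_neg_cancel]
  · change algebraMap F A s * a + -a * algebraMap F A s = 0
    rw [neg_mul, Algebra.commutes, add_neg_cancel]
  · exact e'.symm

/-- The representation of the Clifford algebra of `V` by `2 × 2` matrices over the Clifford algebra
of `⟨v₁, v₂⟩^⊥`. -/
noncomputable def IsHyperbolicPair.cliffordMatrix (h : IsHyperbolicPair Q v₁ v₂) :
    CliffordAlgebra Q →ₐ[F] Matrix (Fin 2) (Fin 2) (CliffordAlgebra (restr Q v₁ v₂)) :=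
  CliffordAlgebra.lift Q
    ⟨{ toFun := fun v =>
        !![CliffordAlgebra.ι _ (h.proj v), algebraMap F _ (polar Q v₂ v);
          algebraMap F _ (polar Q v₁ v), -CliffordAlgebra.ι _ (h.proj v)]
       map_add' := fun v w => by
        ext i j
        fin_cases i <;> fin_cases j <;> simp [polar_add_right, add_comm]
       map_smul' := fun c v => by
        ext i j
        fin_cases i <;> fin_cases j <;> simp [polar_smul_right, Algebra.smul_def] }, fun v => by
      rw [h.map_eq v]
      exact matrix_mul_self_eq_algebraMap (CliffordAlgebra.ι_sq_scalar _ _) _ _⟩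

theorem IsHyperbolicPair.cliffordMatrix_ι (h : IsHyperbolicPair Q v₁ v₂) (v : V) :
    h.cliffordMatrix (CliffordAlgebra.ι Q v) =
      !![CliffordAlgebra.ι _ (h.proj v), algebraMap F _ (polar Q v₂ v);
          algebraMap F _ (polar Q v₁ v), -CliffordAlgebra.ι _ (h.proj v)] :=
  CliffordAlgebra.lift_ι_apply _ _ _

/-- Both sides are anti-multiplicative in `x`, so agreement on vectors suffices. Swapping the
diagonal entries changes the sign of `ι w`, and `involute` on the entries restores it. -/
theorem IsHyperbolicPair.cliffordMatrix_reverse (h : IsHyperbolicPair Q v₁ v₂)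
    (x : CliffordAlgebra Q) : h.cliffordMatrix (CliffordAlgebra.reverse x) =
      ((h.cliffordMatrix x).map fun a => CliffordAlgebra.reverse
        (CliffordAlgebra.involute a)).transpose.submatrix (Equiv.swap 0 1) (Equiv.swap 0 1) := by
  induction x using CliffordAlgebra.induction with
  | algebraMap r =>
    ext i j
    fin_cases i <;> fin_cases j <;> simp [Matrix.algebraMap_matrix_apply]
  | ι v =>
    ext i j
    fin_cases i <;> fin_cases j <;> simp [h.cliffordMatrix_ι]
  | mul a b ha hb =>
    rw [CliffordAlgebra.reverse.map_mul, map_mul, map_mul, ha, hb]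
    refine Matrix.ext (Fin.forall_fin_two.2 ⟨Fin.forall_fin_two.2 ⟨?_, ?_⟩,
        Fin.forall_fin_two.2 ⟨?_, ?_⟩⟩)
    all_goals
      simp only [Matrix.mul_apply, Fin.sum_univ_two, CliffordAlgebra.reverse.map_mul,
        Matrix.submatrix_apply, Matrix.transpose_apply, Matrix.map_apply, map_add, map_mul,
        Equiv.swap_apply_left, Equiv.swap_apply_right]
      exact add_comm _ _
  | add a b ha hb =>
    rw [map_add, map_add, map_add, ha, hb]
    ext i j
    fin_cases i <;> fin_cases j <;> simp

/-- The representation respects the checkerboard grading: a vector has odd diagonal and scalar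
(even) off-diagonal entries, so a product of two vectors has the opposite pattern. -/
theorem IsHyperbolicPair.cliffordMatrix_mem_even (h : IsHyperbolicPair Q v₁ v₂)
    {x : CliffordAlgebra Q} (hx : x ∈ CliffordAlgebra.evenOdd Q 0) (i j : Fin 2) :
    h.cliffordMatrix x i j ∈
      CliffordAlgebra.evenOdd (restr Q v₁ v₂) (if i = j then 0 else 1) := by
  let E : ZMod 2 → Submodule F (CliffordAlgebra (restr Q v₁ v₂)) :=
    CliffordAlgebra.evenOdd (restr Q v₁ v₂)
  have hmul : ∀ {a b k l} (n : ZMod 2), k + l = n → a ∈ E k → b ∈ E l → a * b ∈ E n := by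
    rintro a b k l n rfl ha hb
    exact CliffordAlgebra.evenOdd_mul_le _ k l (Submodule.mul_mem_mul ha hb)
  have hscal : ∀ r, algebraMap F _ r ∈ E 0 := fun r =>
    CliffordAlgebra.one_le_evenOdd_zero _ (Submodule.algebraMap_mem r)
  have hgen : ∀ v i j, h.cliffordMatrix (CliffordAlgebra.ι Q v) i j ∈ E (if i = j then 1 else 0) := by
    intro v i j
    rw [h.cliffordMatrix_ι]
    fin_cases i <;> fin_cases j
    · exact CliffordAlgebra.ι_mem_evenOdd_one _ _
    · exact hscal _
    · exact hscal _
    · exact Submodule.neg_mem _ (CliffordAlgebra.ι_mem_evenOdd_one _ _)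
  induction x, hx using CliffordAlgebra.even_induction generalizing i j with
  | algebraMap r =>
    rw [AlgHom.commutes, Matrix.algebraMap_matrix_apply]
    split_ifs
    · exact hscal r
    · exact Submodule.zero_mem _
  | add x y hx hy ihx ihy =>
    rw [map_add, Matrix.add_apply]
    exact Submodule.add_mem _ (ihx i j) (ihy i j)
  | ι_mul_ι_mul a b x hx ih =>
    rw [map_mul, map_mul, Matrix.mul_apply]
    refine Submodule.sum_mem _ fun k _ => hmul (k := if i = k then 0 else 1)
      (l := if k = j then 0 else 1) _ ?_ ?_ (ih k j)
    · fin_cases i <;> fin_cases j <;> fin_cases k <;> decide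
    · rw [Matrix.mul_apply]
      refine Submodule.sum_mem _ fun l _ => hmul _ ?_ (hgen a i l) (hgen b l k)
      fin_cases i <;> fin_cases l <;> fin_cases k <;> decide

/-- An element implementing `g` commutes with `ι v₁` and `ι v₂`, which act as the two off-diagonal
matrix units. Its matrix is therefore `a` times the identity, and the even element `a` implements
`A` with the same norm. -/
theorem IsSpinorNorm.restrict (h : IsHyperbolicPair Q v₁ v₂) {g : V ≃ₗ[F] V}
    {A : perp Q v₁ v₂ ≃ₗ[F] perp Q v₁ v₂} (h1 : g v₁ = v₁) (h2 : g v₂ = v₂)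
    (hA : ∀ w : perp Q v₁ v₂, g w = A w) {c : Fˣ} (hc : IsSpinorNorm Q g c) :
    IsSpinorNorm (restr Q v₁ v₂) A c := by
  obtain ⟨x, hx, hx1, hx2, hx3⟩ := hc
  let X := h.cliffordMatrix x
  have e1 : h.cliffordMatrix (CliffordAlgebra.ι Q v₁) = !![0, 1; 0, 0] := by
    rw [h.cliffordMatrix_ι, h.proj_left, h.polar_left_self, h.polar_swap]
    simp
  have e2 : h.cliffordMatrix (CliffordAlgebra.ι Q v₂) = !![0, 0; 1, 0] := by
    rw [h.cliffordMatrix_ι, h.proj_right, h.polar_right_self, h.polar_eq_one]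
    simp
  have ew : ∀ w : perp Q v₁ v₂, h.cliffordMatrix (CliffordAlgebra.ι Q w) =
      !![CliffordAlgebra.ι _ w, 0; 0, -CliffordAlgebra.ι _ w] := by
    intro w
    have hw := mem_perp.1 w.2
    rw [h.cliffordMatrix_ι, h.proj_coe, hw.1, hw.2, map_zero]
  have c1 : X * !![0, 1; 0, 0] = !![0, 1; 0, 0] * X := by
    have := congrArg h.cliffordMatrix (hx3 v₁)
    rwa [map_mul, map_mul, h1, e1] at this
  have c2 : X * !![0, 0; 1, 0] = !![0, 0; 1, 0] * X := by
    have := congrArg h.cliffordMatrix (hx3 v₂)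
    rwa [map_mul, map_mul, h2, e2] at this
  have X11 : X 1 1 = X 0 0 := by
    simpa [Matrix.mul_apply, Fin.sum_univ_two] using (congrFun₂ c1 0 1).symm
  have X10 : X 1 0 = 0 := by
    simpa [Matrix.mul_apply, Fin.sum_univ_two] using congrFun₂ c1 1 1
  have X01 : X 0 1 = 0 := by
    simpa [Matrix.mul_apply, Fin.sum_univ_two] using congrFun₂ c2 0 0
  have hev : X 0 0 ∈ CliffordAlgebra.evenOdd (restr Q v₁ v₂) 0 := h.cliffordMatrix_mem_even hx 0 0
  have hrev : h.cliffordMatrix (CliffordAlgebra.reverse x) =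
      !![CliffordAlgebra.reverse (X 0 0), 0; 0, CliffordAlgebra.reverse (X 0 0)] := by
    rw [h.cliffordMatrix_reverse]
    have e := CliffordAlgebra.involute_eq_of_mem_even hev
    ext i j
    fin_cases i <;> fin_cases j
    · change CliffordAlgebra.reverse (CliffordAlgebra.involute (X 1 1)) = _
      rw [X11, e]
      rfl
    · change CliffordAlgebra.reverse (CliffordAlgebra.involute (X 0 1)) = _
      rw [X01, map_zero, map_zero]
      rfl
    · change CliffordAlgebra.reverse (CliffordAlgebra.involute (X 1 0)) = _
      rw [X10, map_zero, map_zero]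
      rfl
    · change CliffordAlgebra.reverse (CliffordAlgebra.involute (X 0 0)) = _
      rw [e]
      rfl
  refine ⟨X 0 0, hev, ?_, ?_, fun w => ?_⟩
  · have := congrArg h.cliffordMatrix hx1
    rw [map_mul, hrev, AlgHom.commutes] at this
    simpa [Matrix.mul_apply, Fin.sum_univ_two, Matrix.algebraMap_matrix_apply]
      using congrFun₂ this 0 0
  · have := congrArg h.cliffordMatrix hx2
    rw [map_mul, hrev, AlgHom.commutes] at this
    simpa [Matrix.mul_apply, Fin.sum_univ_two, Matrix.algebraMap_matrix_apply]
      using congrFun₂ this 0 0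
  · have := congrArg h.cliffordMatrix (hx3 w)
    rw [map_mul, map_mul, hA, ew, ew] at this
    simpa [Matrix.mul_apply, Fin.sum_univ_two] using congrFun₂ this 0 0

end CliffordRestriction

/-! ### Siegel transformations and singular vectors with prescribed pairings. -/

section Siegel

variable {F V : Type*} [Field F] [AddCommGroup V] [Module F V] {Q : QuadraticForm F V}

theorem polar_map_of_mem_GO {g : V ≃ₗ[F] V} (hg : g ∈ GO Q) (x y : V) :
    polar Q (g x) (g y) = polar Q x y := by
  have e : ∀ z, Q (g z) = Q z := hg
  simp only [polar, ← map_add, e]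

theorem polar_self_eq_zero {x : V} (hx : Q x = 0) : polar Q x x = 0 := by
  rw [polar_self, hx, smul_zero]

/-- The Siegel transformation `v ↦ v - f(u, v) x + f(x, v) (u - Q(u) x)` attached to a singular
vector `x` and a vector `u` orthogonal to `x`. -/
noncomputable def siegel (Q : QuadraticForm F V) {x u : V} (hx : Q x = 0) (hxu : polar Q x u = 0) :
    V ≃ₗ[F] V :=
  LinearEquiv.transvection (f := Q.polarBilin x) (v := u - Q u • x)
      (by simp [hxu, polar_self_eq_zero hx]) *
    LinearEquiv.transvection (f := -Q.polarBilin u) (v := x)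
      (by simp [polar_comm Q u, hxu])

theorem siegel_apply {x u : V} (hx : Q x = 0) (hxu : polar Q x u = 0) (v : V) :
    siegel Q hx hxu v = v - polar Q u v • x + polar Q x v • (u - Q u • x) := by
  rw [siegel, LinearEquiv.mul_apply, LinearEquiv.transvection.apply,
    LinearEquiv.transvection.apply]
  simp [polar_add_right, polar_smul_right, polar_self_eq_zero hx]
  module

theorem siegel_apply_of_orthogonal {x u v : V} (hx : Q x = 0) (hxu : polar Q x u = 0)
    (hxv : polar Q x v = 0) (huv : polar Q u v = 0) : siegel Q hx hxu v = v := by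
  rw [siegel_apply, hxv, huv]
  module

theorem siegel_apply_center {x u : V} (hx : Q x = 0) (hxu : polar Q x u = 0) :
    siegel Q hx hxu x = x :=
  siegel_apply_of_orthogonal hx hxu (polar_self_eq_zero hx) (by rw [polar_comm, hxu])

/-- The source of all transitivity below. Since `Q (b - a) = -f(b,a)`, the two multiples of `x` in
the formula cancel. -/
theorem siegel_sub_apply {x a b : V} (hx : Q x = 0) (ha : Q a = 0) (hb : Q b = 0)
    (hxa : polar Q x a = 1) (hxu : polar Q x (b - a) = 0) : siegel Q hx hxu a = b := by
  have e1 : polar Q (b - a) a = polar Q b a := by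
    rw [polar_sub_left, polar_self_eq_zero ha, sub_zero]
  have e2 : Q (b - a) = - polar Q b a := by
    rw [sub_eq_add_neg, QuadraticMap.map_add Q, QuadraticMap.map_neg, polar_neg_right, ha, hb]
    ring
  rw [siegel_apply, hxa, e1, e2]
  module

theorem siegel_mem_GO {x u : V} (hx : Q x = 0) (hxu : polar Q x u = 0) :
    siegel Q hx hxu ∈ GO Q := by
  intro v
  have hux : polar Q u x = 0 := by rw [polar_comm, hxu]
  rw [siegel_apply, show v - polar Q u v • x + polar Q x v • (u - Q u • x) =
    v + (polar Q x v • u + (-(polar Q u v) - polar Q x v * Q u) • x) by module]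
  simp only [QuadraticMap.map_add Q, QuadraticMap.map_smul, polar_add_right, polar_smul_right,
    polar_smul_left, hx, hux, polar_comm Q v u, polar_comm Q v x, smul_eq_mul]
  ring

theorem siegel_isSpinorNorm {x u : V} (hx : Q x = 0) (hxu : polar Q x u = 0) :
    IsSpinorNorm Q (siegel Q hx hxu) 1 := by
  let ι := CliffordAlgebra.ι Q
  have hxx : ι x * ι x = 0 := by rw [CliffordAlgebra.ι_sq_scalar, hx, map_zero]
  have hux : ι u * ι x = - (ι x * ι u) := by
    rw [eq_neg_iff_add_eq_zero, CliffordAlgebra.ι_mul_ι_add_swap, polar_comm, hxu, map_zero]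
  have huu : ι u * ι u = algebraMap F _ (Q u) := CliffordAlgebra.ι_sq_scalar _ _
  have hrev : CliffordAlgebra.reverse (1 + ι u * ι x) = 1 + ι x * ι u := by
    simp [ι, CliffordAlgebra.reverse.map_mul, CliffordAlgebra.reverse.map_one]
  have z1 : ι u * ι x * (ι x * ι u) = 0 := by
    rw [mul_assoc, ← mul_assoc (ι x), hxx, zero_mul, mul_zero]
  have z2 : ι x * ι u * (ι u * ι x) = 0 := by
    rw [mul_assoc, ← mul_assoc (ι u), huu, Algebra.commutes, ← mul_assoc, hxx, zero_mul]
  -- `ι u` and `ι x` anticommute and `ι x` squares to zero, so `1 + ι u * ι x` is unipotent and its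
  -- reversal is its inverse.
  refine ⟨1 + ι u * ι x, ?_, ?_, ?_, fun v => ?_⟩
  · exact Subalgebra.add_mem _ (Subalgebra.one_mem _)
      (CliffordAlgebra.ι_mul_ι_mem_evenOdd_zero Q u x)
  · rw [hrev, mul_add, add_mul, add_mul, z1, hux]
    simp
  · rw [hrev, mul_add, add_mul, add_mul, z2, hux]
    simp
  · have hxv : ι x * ι v = algebraMap F _ (polar Q x v) - ι v * ι x := by
      rw [eq_sub_iff_add_eq, CliffordAlgebra.ι_mul_ι_add_swap]
    have huv : ι u * ι v = algebraMap F _ (polar Q u v) - ι v * ι u := by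
      rw [eq_sub_iff_add_eq, CliffordAlgebra.ι_mul_ι_add_swap]
    have l : (1 + ι u * ι x) * ι v =
        ι v + polar Q x v • ι u - polar Q u v • ι x + ι v * (ι u * ι x) := by
      rw [add_mul, one_mul, mul_assoc, hxv, mul_sub, ← mul_assoc, huv, sub_mul,
        ← Algebra.commutes, ← Algebra.smul_def, ← Algebra.smul_def, mul_assoc]
      abel
    have xux : ι x * (ι u * ι x) = 0 := by
      rw [hux, mul_neg, ← mul_assoc, hxx, zero_mul, neg_zero]
    have uux : ι u * (ι u * ι x) = Q u • ι x := by
      rw [← mul_assoc, huu, Algebra.smul_def]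
    change (1 + ι u * ι x) * ι v = ι (siegel Q hx hxu v) * (1 + ι u * ι x)
    rw [l, siegel_apply]
    simp only [map_add, map_sub, map_smul, mul_add, mul_one, add_mul, sub_mul, smul_mul_assoc, xux,
      uux, smul_zero, sub_zero]
    rw [smul_sub]
    abel

theorem Nonsingular.exists_polar_eq_one (hQ : Nonsingular Q) {x : V} (hx : x ≠ 0) :
    ∃ v, polar Q x v = 1 := by
  by_contra! h
  refine hx ((nonsingular_iff Q).1 hQ x fun y => ?_)
  by_contra hy
  exact h ((polar Q x y)⁻¹ • y) (by rw [polar_smul_right, smul_eq_mul, inv_mul_cancel₀ hy])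

theorem Nonsingular.exists_polar_eq_zero_one (hQ : Nonsingular Q) {x u : V} (hx : x ≠ 0)
    (hu : ∀ c : F, u ≠ c • x) : ∃ v, polar Q x v = 0 ∧ polar Q u v = 1 := by
  obtain ⟨y, hy⟩ := hQ.exists_polar_eq_one hx
  obtain ⟨z, hz⟩ := hQ.exists_polar_eq_one (sub_ne_zero.2 (hu (polar Q u y)))
  -- Subtracting the multiple of `y` kills the pairing with `x`; the pairing with `u` becomes `f(u -
  -- f(u,y) x, z)`, which is `1` by the choice of `z`.
  refine ⟨z - polar Q x z • y, ?_, ?_⟩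
  · simp [polar_sub_right, polar_smul_right, hy]
  · rw [polar_sub_left, polar_smul_left, smul_eq_mul] at hz
    rw [polar_sub_right, polar_smul_right, smul_eq_mul, ← hz]
    ring

/-- If `x` and `u` are dependent the transformation is the identity. Otherwise `1 - g` factors as a
surjection onto `F × F` followed by an injection, so its rank is `2`. -/
theorem siegel_qdet (hQ : Nonsingular Q) {x u : V} (hx : Q x = 0) (hxu : polar Q x u = 0) :
    qdet (siegel Q hx hxu) = 0 := by
  by_cases hind : x = 0 ∨ ∃ c : F, u = c • x
  · have : LinearMap.id - (siegel Q hx hxu : V →ₗ[F] V) = 0 := by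
      ext v
      rcases hind with rfl | ⟨c, rfl⟩
      · simp [siegel_apply]
      · simp only [LinearMap.sub_apply, LinearMap.id_apply, LinearEquiv.coe_coe, siegel_apply,
          QuadraticMap.map_smul, hx, polar_smul_left, LinearMap.zero_apply]
        module
    rw [qdet, this, LinearMap.range_zero, finrank_bot, Nat.cast_zero]
  · push Not at hind
    obtain ⟨hx0, hu⟩ := hind
    let L : V →ₗ[F] F × F := (Q.polarBilin x).prod (Q.polarBilin u)
    let M : F × F →ₗ[F] V :=
      (LinearMap.toSpanSingleton F V (Q u • x - u)).coprod (LinearMap.toSpanSingleton F V x)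
    have hML : LinearMap.id - (siegel Q hx hxu : V →ₗ[F] V) = M ∘ₗ L := by
      ext v
      change v - siegel Q hx hxu v = polar Q x v • (Q u • x - u) + polar Q u v • x
      rw [siegel_apply]
      module
    have hL : LinearMap.range L = ⊤ := by
      rw [LinearMap.range_eq_top]
      rintro ⟨r, s⟩
      obtain ⟨y, hy⟩ := hQ.exists_polar_eq_one hx0
      obtain ⟨z, hz, hz'⟩ := hQ.exists_polar_eq_zero_one hx0 hu
      refine ⟨r • y + (s - r * polar Q u y) • z, ?_⟩
      simp [L, polar_add_right, polar_smul_right, hy, hz, hz']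
    have hM : Function.Injective M := by
      rw [← LinearMap.ker_eq_bot, LinearMap.ker_eq_bot']
      rintro ⟨r, s⟩ hrs
      have hrs' : r • (Q u • x - u) + s • x = 0 := hrs
      have hr : r = 0 := by
        by_contra hr
        refine hu (Q u + r⁻¹ * s) ?_
        have := congrArg (r⁻¹ • ·) hrs'
        simp only [smul_add, smul_zero, smul_smul, inv_mul_cancel₀ hr, one_smul] at this
        rw [add_smul]
        rw [sub_add_eq_add_sub, sub_eq_zero] at this
        exact this.symm
      subst hr
      rw [zero_smul, zero_add, smul_eq_zero, or_iff_left hx0] at hrs'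
      rw [hrs']
      rfl
    rw [qdet, hML, LinearMap.range_comp_of_range_eq_top _ hL, LinearMap.finrank_range_of_inj hM,
      finrank_prod, finrank_self]
    rfl

theorem siegel_mem_Omega [FiniteDimensional F V] (hQ : Nonsingular Q) {x u : V} (hx : Q x = 0)
    (hxu : polar Q x u = 0) : siegel Q hx hxu ∈ Omega Q hQ := by
  refine ⟨⟨siegel_mem_GO hx hxu, fun _ => ?_, fun _ => siegel_qdet hQ hx hxu⟩, 1,
    siegel_isSpinorNorm hx hxu, IsSquare.one⟩
  rw [siegel, map_mul, LinearEquiv.transvection.det_eq_one, LinearEquiv.transvection.det_eq_one,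
    one_mul]

theorem Nonsingular.exists_singular_polar_eq_one (hQ : Nonsingular Q) {a b : V} (ha : Q a = 0)
    (hab : polar Q a b = 0) (ha0 : a ≠ 0) (hb : ∀ c : F, b ≠ c • a) :
    ∃ x, Q x = 0 ∧ polar Q a x = 1 ∧ polar Q b x = 1 := by
  obtain ⟨y, hy⟩ := hQ.exists_polar_eq_one ha0
  obtain ⟨z, hz, hz'⟩ := hQ.exists_polar_eq_zero_one ha0 hb
  obtain ⟨x, hx, hx'⟩ : ∃ x, polar Q a x = 1 ∧ polar Q b x = 1 := by
    refine ⟨y + (1 - polar Q b y) • z, ?_, ?_⟩ <;>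
      simp [polar_add_right, polar_smul_right, hy, hz, hz']
  -- Because `f(a,x) = 1`, this correction makes the vector singular; because `a` is orthogonal to
  -- `a` and `b`, it leaves both pairings unchanged.
  refine ⟨x - Q x • a, ?_, ?_, ?_⟩
  · rw [sub_eq_add_neg, ← neg_smul, QuadraticMap.map_add Q, QuadraticMap.map_smul, ha,
      polar_smul_right, polar_comm, hx]
    simp
  · rw [polar_sub_right, polar_smul_right, polar_self_eq_zero ha, hx]
    simp
  · rw [polar_sub_right, polar_smul_right, polar_comm Q b a, hab, hx']
    simp

theorem Nonsingular.exists_ne_zero (hQ : Nonsingular Q) [Nontrivial V] : ∃ v, Q v ≠ 0 := by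
  by_contra! h
  obtain ⟨x, hx⟩ := exists_ne (0 : V)
  obtain ⟨y, hy⟩ := hQ.exists_polar_eq_one hx
  simp [polar, h] at hy

theorem IsHyperbolicPair.finrank_le_two {v₁ v₂ : V} (h : IsHyperbolicPair Q v₁ v₂)
    [FiniteDimensional F V] (h0 : ∀ w : perp Q v₁ v₂, w = 0) : finrank F V ≤ 2 := by
  let M : F × F →ₗ[F] V :=
    (LinearMap.toSpanSingleton F V v₁).coprod (LinearMap.toSpanSingleton F V v₂)
  have hM : Function.Surjective M := by
    intro v
    refine ⟨(polar Q v₂ v, polar Q v₁ v), ?_⟩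
    have := h.eq_add v
    rw [h0 (h.proj v), Submodule.coe_zero, add_zero] at this
    exact this.symm
  have := LinearMap.finrank_range_le M
  rwa [LinearMap.range_eq_top.2 hM, finrank_top, finrank_prod, finrank_self] at this

/-- Two singular points in dimension at least three have a common non-orthogonal singular point. -/
theorem Nonsingular.exists_singular_polar_ne_zero [FiniteDimensional F V] (hQ : Nonsingular Q)
    (hd : 2 < finrank F V) {a b : V} (ha : Q a = 0) (hb : Q b = 0) (ha0 : a ≠ 0) (hb0 : b ≠ 0) :
    ∃ x, Q x = 0 ∧ polar Q x a ≠ 0 ∧ polar Q x b ≠ 0 := by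
  by_cases hc : ∃ c : F, b = c • a
  · obtain ⟨c, rfl⟩ := hc
    have hc0 : c ≠ 0 := by
      rintro rfl
      exact hb0 (zero_smul _ _)
    obtain ⟨y, hy⟩ := hQ.exists_polar_eq_one ha0
    have hxa : polar Q (y - Q y • a) a = 1 := by
      rw [polar_sub_left, polar_smul_left, polar_self_eq_zero ha, polar_comm, hy]
      simp
    refine ⟨y - Q y • a, ?_, ?_, ?_⟩
    · rw [sub_eq_add_neg, ← neg_smul, QuadraticMap.map_add Q, QuadraticMap.map_smul, ha,
        polar_smul_right, polar_comm, hy]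
      simp
    · rw [hxa]
      exact one_ne_zero
    · rw [polar_smul_right, hxa]
      simpa using hc0
  push Not at hc
  by_cases hab : polar Q a b = 0
  · obtain ⟨x, hx, h1, h2⟩ := hQ.exists_singular_polar_eq_one ha hab ha0 hc
    exact ⟨x, hx, by simp [polar_comm Q x, h1], by simp [polar_comm Q x, h2]⟩
  · have hp : IsHyperbolicPair Q a ((polar Q a b)⁻¹ • b) :=
      ⟨ha, by rw [QuadraticMap.map_smul, hb, smul_zero],
        by rw [polar_smul_right, smul_eq_mul, inv_mul_cancel₀ hab]⟩
    have : Nontrivial (perp Q a ((polar Q a b)⁻¹ • b)) := by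
      by_contra hn
      rw [not_nontrivial_iff_subsingleton] at hn
      exact hd.not_ge (hp.finrank_le_two fun w => Subsingleton.elim _ _)
    obtain ⟨w, hwa, hwb, hw0⟩ : ∃ w, polar Q w a = 0 ∧ polar Q w b = 0 ∧ Q w ≠ 0 := by
      obtain ⟨w, hw⟩ := (hp.nonsingular_restr hQ).exists_ne_zero
      obtain ⟨hwa, hwb⟩ := mem_perp.1 w.2
      rw [polar_smul_left, smul_eq_mul] at hwb
      exact ⟨w, by rw [polar_comm, hwa],
        by rw [polar_comm, (mul_eq_zero.1 hwb).resolve_left (inv_ne_zero hab)], hw⟩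
    -- The coefficient of `b` is chosen so that the hyperbolic part contributes `-Q w`, cancelling
    -- `Q w`. The pairing with `a` is then `-Q w`, which is why a non-singular `w` orthogonal to `a`
    -- and `b`, hence dimension above two, is needed.
    refine ⟨a + w - (Q w * (polar Q a b)⁻¹) • b, ?_, ?_, ?_⟩
    · rw [sub_eq_add_neg, ← neg_smul, QuadraticMap.map_add Q, QuadraticMap.map_add Q,
        QuadraticMap.map_smul, ha, hb, polar_comm Q a w, hwa, polar_smul_right, polar_add_left, hwb]
      simp [hab]
    · rw [polar_sub_left, polar_add_left, polar_self_eq_zero ha, hwa, polar_smul_left,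
        polar_comm Q b a]
      simp [hab, hw0]
    · rw [polar_sub_left, polar_add_left, hwb, polar_smul_left, polar_self_eq_zero hb]
      simpa using hab

end Siegel

/-! ### The stabiliser of a singular vector. -/

section Stabilizer

variable {F V : Type*} [Field F] [AddCommGroup V] [Module F V] {Q : QuadraticForm F V} {v₁ v₂ : V}

/-- An isometry fixing a hyperbolic pair restricts to its orthogonal complement. -/
theorem exists_restrict_of_mem_GO {g : V ≃ₗ[F] V} (hg : g ∈ GO Q) (h1 : g v₁ = v₁)
    (h2 : g v₂ = v₂) :
    ∃ A : perp Q v₁ v₂ ≃ₗ[F] perp Q v₁ v₂, ∀ w : perp Q v₁ v₂, g w = A w := by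
  have hm : ∀ w, g w ∈ perp Q v₁ v₂ ↔ w ∈ perp Q v₁ v₂ := by
    intro w
    have e1 := polar_map_of_mem_GO hg v₁ w
    have e2 := polar_map_of_mem_GO hg v₂ w
    rw [h1] at e1
    rw [h2] at e2
    rw [mem_perp, mem_perp, e1, e2]
  refine ⟨g.ofSubmodules _ _ ?_, fun w => rfl⟩
  ext w
  rw [Submodule.mem_map]
  constructor
  · rintro ⟨w, hw, rfl⟩
    exact (hm w).2 hw
  · intro hw
    exact ⟨g.symm w, (hm _).1 (by simpa using hw), by simp⟩

/-- Everything rests on `v - g v = w - A w`, with `w` the projection of `v` to `W`. So `g` is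
trivial on `V / W`, which gives equal determinants, and `1 - g` and `1 - A` have the same image. -/
theorem IsHyperbolicPair.restrict_mem_Omega [FiniteDimensional F V]
    (h : IsHyperbolicPair Q v₁ v₂) (hQ : Nonsingular Q) {g : V ≃ₗ[F] V}
    (hg : g ∈ Omega Q hQ) (h1 : g v₁ = v₁) (h2 : g v₂ = v₂)
    {A : perp Q v₁ v₂ ≃ₗ[F] perp Q v₁ v₂} (hA : ∀ w : perp Q v₁ v₂, g w = A w) :
    A ∈ Omega (restr Q v₁ v₂) (h.nonsingular_restr hQ) := by
  obtain ⟨⟨hgo, hdet, hqdet⟩, c, hc, hc'⟩ := hg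
  have hsub : ∀ v, v - g v = ((h.proj v - A (h.proj v) : perp Q v₁ v₂) : V) := by
    intro v
    rw [Submodule.coe_sub, ← hA]
    have e := h.eq_add v
    have e' := congrArg g e
    rw [map_add, map_add, map_smul, map_smul, h1, h2] at e'
    rw [e']
    nth_rewrite 1 [e]
    abel
  refine ⟨⟨fun w => ?_, fun hF => ?_, fun hF => ?_⟩, c, hc.restrict h h1 h2 hA, hc'⟩
  · change Q (A w : V) = Q (w : V)
    rw [← hA]
    exact hgo w
  · have hle : perp Q v₁ v₂ ≤ (perp Q v₁ v₂).comap (g : V →ₗ[F] V) := by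
      intro w hw
      have := hA ⟨w, hw⟩
      change g w ∈ perp Q v₁ v₂
      exact this ▸ (A ⟨w, hw⟩).2
    have hd := LinearMap.det_eq_det_mul_det (perp Q v₁ v₂) (g : V →ₗ[F] V) hle
    have hr : (g : V →ₗ[F] V).restrict hle = (A : perp Q v₁ v₂ →ₗ[F] perp Q v₁ v₂) := by
      ext w
      exact hA w
    have hq : (perp Q v₁ v₂).mapQ (perp Q v₁ v₂) (g : V →ₗ[F] V) hle = LinearMap.id := by
      refine Submodule.linearMap_qext _ (LinearMap.ext fun v => ?_)
      change Submodule.Quotient.mk (g v) = Submodule.Quotient.mk v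
      refine ((Submodule.Quotient.eq _).2 ?_).symm
      rw [hsub]
      exact Submodule.coe_mem _
    rw [hr, hq, LinearMap.det_id, mul_one, ← LinearEquiv.coe_det, ← LinearEquiv.coe_det, hdet hF]
      at hd
    exact Units.ext hd.symm
  · have hr : LinearMap.range (LinearMap.id - (g : V →ₗ[F] V)) =
        (LinearMap.range (LinearMap.id - (A : perp Q v₁ v₂ →ₗ[F] perp Q v₁ v₂))).map
          (perp Q v₁ v₂).subtype := by
      ext v
      simp only [Submodule.mem_map, LinearMap.mem_range]
      constructor
      · rintro ⟨y, rfl⟩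
        exact ⟨_, ⟨h.proj y, rfl⟩, (hsub y).symm⟩
      · rintro ⟨_, ⟨y, rfl⟩, rfl⟩
        refine ⟨y, ?_⟩
        change (y : V) - g y = ((y - A y : perp Q v₁ v₂) : V)
        rw [hA, Submodule.coe_sub]
    have := hqdet hF
    rwa [qdet, hr, Submodule.finrank_map_subtype_eq] at this

/-- The stabiliser of the vector `v₁` in `Ω(F, Q)` is `W : Ω(F, Q_W)`. -/
theorem IsHyperbolicPair.mem_WOmega_of_fixes [FiniteDimensional F V]
    (h : IsHyperbolicPair Q v₁ v₂) (hQ : Nonsingular Q)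
    {g : V ≃ₗ[F] V} (hg : g ∈ Omega Q hQ) (h1 : g v₁ = v₁) : g ∈ WOmega Q hQ h := by
  have hgo := hg.1.1
  have hy : Q (g v₂) = 0 := by rw [hgo v₂, h.right]
  have hy1 : polar Q v₁ (g v₂) = 1 := by
    have := polar_map_of_mem_GO hgo v₁ v₂
    rwa [h1, h.polar_eq_one] at this
  let u := h.proj (g v₂)
  have hu := mem_perp.1 u.2
  have hQu : Q (u : V) + polar Q v₂ (g v₂) = 0 := by
    have := h.map_eq (g v₂)
    rw [hy, hy1, mul_one] at this
    exact this.symm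
  have hgv : g v₂ = - (Q (u : V) • v₁) + u + v₂ := by
    conv_lhs => rw [h.eq_add (g v₂), hy1, one_smul]
    rw [eq_neg_of_add_eq_zero_right hQu, neg_smul]
  -- `k` agrees with `g` on `v₁` and `v₂`, so `k⁻¹ * g` fixes the hyperbolic pair and restricts to
  -- `W`.
  let k := siegel Q h.left hu.1
  have hk1 : k v₁ = v₁ := siegel_apply_center _ _
  have hk2 : k v₂ = g v₂ := by
    rw [siegel_apply, h.polar_eq_one, polar_comm, hu.2, hgv]
    module
  have hinv : ∀ x y, k y = x → k⁻¹ x = y := by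
    rintro _ y rfl
    rw [← LinearEquiv.mul_apply, inv_mul_cancel, LinearEquiv.coe_one, id]
  have hm : k⁻¹ * g ∈ Omega Q hQ :=
    Subgroup.mul_mem _ (Subgroup.inv_mem _ (siegel_mem_Omega hQ h.left hu.1)) hg
  have e1 : (k⁻¹ * g) v₁ = v₁ := by rw [LinearEquiv.mul_apply, h1, hinv _ _ hk1]
  have e2 : (k⁻¹ * g) v₂ = v₂ := by rw [LinearEquiv.mul_apply, hinv _ _ hk2]
  obtain ⟨A, hA⟩ := exists_restrict_of_mem_GO hm.1.1 e1 e2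
  refine ⟨A, h.restrict_mem_Omega hQ hm e1 e2 hA, u, h1, fun w => ?_, hgv⟩
  have e3 : g w = k (A w) := by
    rw [← hA, ← LinearEquiv.mul_apply, mul_inv_cancel_left]
  rw [e3, siegel_apply, (mem_perp.1 (A w).2).1, polar_comm]
  module

end Stabilizer

/-! ### Orbits on singular points and generation of `Omega`. -/

section Orbits

variable {F V : Type*} [Field F] [AddCommGroup V] [Module F V] {Q : QuadraticForm F V} {v₁ v₂ : V}

theorem IsHyperbolicPair.coe_ne_smul (hv : IsHyperbolicPair Q v₁ v₂) {w : perp Q v₁ v₂}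
    (hw : w ≠ 0) (c : F) : (w : V) ≠ c • v₁ := by
  intro hc
  have hw2 := (mem_perp.1 w.2).2
  rw [hc, polar_smul_right, hv.polar_swap, smul_eq_mul, mul_one] at hw2
  rw [hw2, zero_smul] at hc
  exact hw (Subtype.ext hc)

/-- The vector `y` spans a point in the orbit of `⟨v⟩` under `H`. -/
def InPointOrbit (H : Subgroup (V ≃ₗ[F] V)) (v y : V) : Prop :=
  ∃ h ∈ H, ∃ c : F, c ≠ 0 ∧ h v = c • y

theorem InPointOrbit.map {H : Subgroup (V ≃ₗ[F] V)} {v y : V} (hy : InPointOrbit H v y)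
    {k : V ≃ₗ[F] V} (hk : k ∈ H) : InPointOrbit H v (k y) := by
  obtain ⟨h, hh, c, hc, e⟩ := hy
  exact ⟨k * h, H.mul_mem hk hh, c, hc, by rw [LinearEquiv.mul_apply, e, map_smul]⟩

theorem InPointOrbit.smul {H : Subgroup (V ≃ₗ[F] V)} {v y : V} {c : F} (hc : c ≠ 0)
    (hy : InPointOrbit H v y) : InPointOrbit H v (c • y) := by
  obtain ⟨h, hh, d, hd, e⟩ := hy
  exact ⟨h, hh, d * c⁻¹, mul_ne_zero hd (inv_ne_zero hc), by
    rw [e, smul_smul, inv_mul_cancel_right₀ hc]⟩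

/-- Rescale `y` and `z` to pair to `1` with `x`; `siegel_sub_apply` then moves one to the other. The
scalars in `hH` allow for this rescaling. -/
theorem InPointOrbit.of_siegel {H : Subgroup (V ≃ₗ[F] V)} {x y z : V}
    (hx : Q x = 0) (hy : Q y = 0) (hz : Q z = 0) (hxy : polar Q x y ≠ 0) (hxz : polar Q x z ≠ 0)
    (hH : ∀ a b : F, ∀ hu : polar Q x (b • z - a • y) = 0, siegel Q hx hu ∈ H)
    (ho : InPointOrbit H v₁ y) : InPointOrbit H v₁ z := by
  have h1 : polar Q x ((polar Q x y)⁻¹ • y) = 1 := by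
    rw [polar_smul_right, smul_eq_mul, inv_mul_cancel₀ hxy]
  have h2 : polar Q x ((polar Q x z)⁻¹ • z) = 1 := by
    rw [polar_smul_right, smul_eq_mul, inv_mul_cancel₀ hxz]
  have hu : polar Q x ((polar Q x z)⁻¹ • z - (polar Q x y)⁻¹ • y) = 0 := by
    rw [polar_sub_right, h1, h2, sub_self]
  have h3 := (ho.smul (inv_ne_zero hxy)).map (hH _ _ hu)
  rw [siegel_sub_apply hx (by rw [QuadraticMap.map_smul, hy, smul_zero])
    (by rw [QuadraticMap.map_smul, hz, smul_zero]) h1 hu] at h3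
  have h4 := h3.smul hxz
  rwa [smul_smul, mul_inv_cancel₀ hxz, one_smul] at h4

variable [FiniteDimensional F V]

theorem exists_totally_singular_of_two_le_wittIndex (h : 2 ≤ wittIndex Q) :
    ∃ U : Submodule F V, (∀ u ∈ U, Q u = 0) ∧ 2 ≤ finrank F U := by
  have hmem : wittIndex Q ∈ {d | ∃ U : Submodule F V, (∀ u ∈ U, Q u = 0) ∧ finrank F U = d} := by
    -- The supremum is attained because the set of dimensions is nonempty and bounded, so `sSup` is
    -- not the default value here.
    refine Nat.sSup_mem ⟨0, ⊥, ?_, finrank_bot F V⟩ ⟨finrank F V, ?_⟩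
    · intro u hu
      rw [(Submodule.mem_bot F).1 hu, QuadraticMap.map_zero]
    · rintro d ⟨U, -, rfl⟩
      exact U.finrank_le
  obtain ⟨U, hU, hd⟩ := hmem
  exact ⟨U, hU, hd ▸ h⟩

theorem exists_singular_ne_zero_of_two_le_wittIndex (h : 2 ≤ wittIndex Q) :
    ∃ w, Q w = 0 ∧ w ≠ 0 := by
  obtain ⟨U, hU, hd⟩ := exists_totally_singular_of_two_le_wittIndex h
  have : Nontrivial U := Module.nontrivial_of_finrank_pos (R := F) (by omega)
  obtain ⟨w, hw⟩ := exists_ne (0 : U)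
  exact ⟨w, hU w w.2, fun e => hw (Subtype.ext e)⟩

/-- In dimension at most two the totally singular subspace would be everything, forcing `Q = 0`. -/
theorem Nonsingular.two_lt_finrank_of_two_le_wittIndex (hQ : Nonsingular Q)
    (h : 2 ≤ wittIndex Q) : 2 < finrank F V := by
  obtain ⟨U, hU, hd⟩ := exists_totally_singular_of_two_le_wittIndex h
  by_contra! hlt
  have hle := U.finrank_le
  have htop : U = ⊤ := Submodule.eq_top_of_finrank_eq (by omega)
  have : Nontrivial V := Module.nontrivial_of_finrank_pos (R := F) (by omega)
  obtain ⟨v, hv⟩ := hQ.exists_ne_zero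
  exact hv (hU v (htop ▸ Submodule.mem_top))

variable {H : Subgroup (V ≃ₗ[F] V)}

variable (hQ : Nonsingular Q) (hv : IsHyperbolicPair Q v₁ v₂)
  (hS : ∀ g ∈ Omega Q hQ, g v₁ = v₁ → g ∈ H)

include hQ hv hS

theorem IsHyperbolicPair.inPointOrbit_of_not_orthogonal {y z : V} (hy : Q y = 0) (hz : Q z = 0)
    (hvy : polar Q v₁ y ≠ 0) (hvz : polar Q v₁ z ≠ 0) (ho : InPointOrbit H v₁ y) :
    InPointOrbit H v₁ z :=
  ho.of_siegel hv.left hy hz hvy hvz fun _ _ hu =>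
    hS _ (siegel_mem_Omega hQ _ hu) (siegel_apply_center _ hu)

/-- Modulo `v₁`, `y` and `z` are nonzero singular vectors of `W`. A singular `x` in `W` orthogonal
to neither is the centre of a Siegel transformation joining their points; it fixes `v₁`, since `x`,
`y` and `z` are orthogonal to `v₁`. -/
theorem IsHyperbolicPair.inPointOrbit_of_orthogonal (hW : 2 ≤ wittIndex (restr Q v₁ v₂)) {y z : V}
    (hy : Q y = 0) (hz : Q z = 0) (hvy : polar Q v₁ y = 0) (hvz : polar Q v₁ z = 0)
    (hy' : ∀ c : F, y ≠ c • v₁) (hz' : ∀ c : F, z ≠ c • v₁) (ho : InPointOrbit H v₁ y) :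
    InPointOrbit H v₁ z := by
  have hns := hv.nonsingular_restr hQ
  have key : ∀ y, Q y = 0 → polar Q v₁ y = 0 → (∀ c : F, y ≠ c • v₁) →
      restr Q v₁ v₂ (hv.proj y) = 0 ∧ hv.proj y ≠ 0 ∧
      ∀ x : perp Q v₁ v₂, polar Q (x : V) y = polar (restr Q v₁ v₂) x (hv.proj y) := by
    intro y hy hvy hy'
    refine ⟨?_, fun h0 => hy' (polar Q v₂ y) ?_, fun x => ?_⟩
    · have := hv.map_eq y
      rw [hy, hvy, mul_zero, add_zero] at this
      exact this.symm
    · have := hv.eq_add y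
      rwa [h0, hvy, Submodule.coe_zero, zero_smul, add_zero, add_zero] at this
    · have hx := (mem_perp.1 x.2).1
      rw [polar_comm] at hx
      conv_lhs => rw [hv.eq_add y, hvy, zero_smul, add_zero, polar_add_right, polar_smul_right, hx]
      rw [smul_zero, zero_add]
      rfl
  obtain ⟨hy1, hy2, hy3⟩ := key y hy hvy hy'
  obtain ⟨hz1, hz2, hz3⟩ := key z hz hvz hz'
  obtain ⟨x, hx, hxy, hxz⟩ := hns.exists_singular_polar_ne_zero
    (hns.two_lt_finrank_of_two_le_wittIndex hW) hy1 hz1 hy2 hz2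
  have hx0 : Q (x : V) = 0 := hx
  rw [← hy3] at hxy
  rw [← hz3] at hxz
  refine ho.of_siegel hx0 hy hz hxy hxz fun a b hu => hS _ (siegel_mem_Omega hQ _ hu) ?_
  refine siegel_apply_of_orthogonal _ hu ?_ ?_
  · rw [polar_comm, (mem_perp.1 x.2).1]
  · rw [polar_comm, polar_sub_right, polar_smul_right, polar_smul_right, hvy, hvz]
    simp

/-- If `H` moves `⟨v₁⟩`, then it is transitive on singular points. -/
theorem IsHyperbolicPair.inPointOrbit (hW : 2 ≤ wittIndex (restr Q v₁ v₂)) (hGO : H ≤ GO Q)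
    {h₀ : V ≃ₗ[F] V} (hh₀ : h₀ ∈ H) (hmove : ∀ c : F, h₀ v₁ ≠ c • v₁) {z : V} (hz : Q z = 0)
    (hz0 : z ≠ 0) : InPointOrbit H v₁ z := by
  have hns := hv.nonsingular_restr hQ
  have hself : InPointOrbit H v₁ v₁ := ⟨1, H.one_mem, 1, one_ne_zero, (one_smul _ _).symm⟩
  obtain ⟨w, hw, hw0⟩ := exists_singular_ne_zero_of_two_le_wittIndex hW
  have hw' : Q (w : V) = 0 := hw
  have hw1 := mem_perp.1 w.2
  -- Pulling an orbit point `b` back by `h` turns its position relative to `h v₁` into a position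
  -- relative to `v₁`. This is how a point of the missing family is produced from the known one.
  have hback : ∀ {h : V ≃ₗ[F] V} {b : V}, h ∈ H → InPointOrbit H v₁ b →
      ∃ y, h y = b ∧ Q y = Q b ∧ InPointOrbit H v₁ y ∧ polar Q v₁ y = polar Q (h v₁) b := by
    intro h b hh hb
    have e : h (h⁻¹ b) = b := by
      rw [← LinearEquiv.mul_apply, mul_inv_cancel, LinearEquiv.coe_one, id]
    refine ⟨h⁻¹ b, e, hGO (H.inv_mem hh) b, hb.map (H.inv_mem hh), ?_⟩
    rw [← polar_map_of_mem_GO (hGO hh) v₁, e]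
  obtain ⟨⟨y, hy, hvy, hyo⟩, ⟨y', hy', hvy', hyc, hyo'⟩⟩ :
      (∃ y, Q y = 0 ∧ polar Q v₁ y ≠ 0 ∧ InPointOrbit H v₁ y) ∧
      (∃ y, Q y = 0 ∧ polar Q v₁ y = 0 ∧ (∀ c : F, y ≠ c • v₁) ∧ InPointOrbit H v₁ y) := by
    have hq0 : Q (h₀ v₁) = 0 := (hGO hh₀ v₁).trans hv.left
    have ho0 := hself.map hh₀
    by_cases hp : polar Q v₁ (h₀ v₁) = 0
    · refine ⟨?_, h₀ v₁, hq0, hp, hmove, ho0⟩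
      have hall : ∀ w : perp Q v₁ v₂, restr Q v₁ v₂ w = 0 → w ≠ 0 → InPointOrbit H v₁ (w : V) :=
        fun w hw hw0 => hv.inPointOrbit_of_orthogonal hQ hS hW hq0 hw hp (mem_perp.1 w.2).1 hmove
          (hv.coe_ne_smul hw0) ho0
      -- Both `w` and some singular `x` in `W` not orthogonal to `w` span orbit points. Pulling back
      -- by `h`, which sends `⟨v₁⟩` to `⟨w⟩`, yields a point not orthogonal to `v₁`.
      obtain ⟨h, hh, c, hc, e⟩ := hall w hw hw0
      obtain ⟨x, hx, hxw, -⟩ := hns.exists_singular_polar_ne_zero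
        (hns.two_lt_finrank_of_two_le_wittIndex hW) hw hw hw0 hw0
      have hx0 : x ≠ 0 := by
        rintro rfl
        simp at hxw
      obtain ⟨y, -, hy, ho, hp⟩ := hback hh (hall x hx hx0)
      refine ⟨y, hy.trans hx, ?_, ho⟩
      rw [hp, e, polar_smul_left, polar_comm]
      exact mul_ne_zero hc hxw
    · refine ⟨⟨h₀ v₁, hq0, hp, ho0⟩, ?_⟩
      have hall : ∀ z, Q z = 0 → polar Q v₁ z ≠ 0 → InPointOrbit H v₁ z :=
        fun z hz hvz => hv.inPointOrbit_of_not_orthogonal hQ hS hq0 hz hp hvz ho0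
      -- Both `v₂` and `w + v₂` are singular and not orthogonal to `v₁`, yet orthogonal to each
      -- other and independent. Pulling back by `h`, which sends `⟨v₁⟩` to `⟨v₂⟩`, yields a point
      -- orthogonal to, and distinct from, `⟨v₁⟩`.
      obtain ⟨h, hh, c, hc, e⟩ := hall v₂ hv.right (by rw [hv.polar_eq_one]; exact one_ne_zero)
      have hq : Q ((w : V) + v₂) = 0 := by
        rw [QuadraticMap.map_add Q, hw', hv.right, polar_comm, hw1.2]
        simp
      obtain ⟨y, hyw, hy, ho, hp'⟩ := hback hh (hall ((w : V) + v₂) hq (by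
        rw [polar_add_right, hw1.1, hv.polar_eq_one, zero_add]; exact one_ne_zero))
      refine ⟨y, hy.trans hq, ?_, fun d hd => ?_, ho⟩
      · rw [hp', e, polar_smul_left, polar_add_right, hw1.2, hv.polar_right_self]
        simp
      · rw [hd, map_smul, e, smul_smul] at hyw
        have h1 := congrArg (polar Q v₁) hyw
        rw [polar_smul_right, polar_add_right, hw1.1, hv.polar_eq_one, zero_add, smul_eq_mul,
          mul_one] at h1
        rw [h1, one_smul] at hyw
        exact hw0 (Subtype.ext (right_eq_add.1 hyw))
  by_cases hvz : polar Q v₁ z = 0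
  · by_cases hc : ∃ c : F, z = c • v₁
    · obtain ⟨c, rfl⟩ := hc
      exact hself.smul fun h0 => hz0 (by rw [h0, zero_smul])
    · push Not at hc
      exact hv.inPointOrbit_of_orthogonal hQ hS hW hy' hz hvy' hvz hyc hc hyo'
  · exact hv.inPointOrbit_of_not_orthogonal hQ hS hy hz hvy hvz hyo

/-- If `H` contains the stabiliser of `v₁` in `Ω(F, Q)` and moves `⟨v₁⟩`, then it contains
`Ω(F, Q)`. -/
theorem IsHyperbolicPair.Omega_le (hW : 2 ≤ wittIndex (restr Q v₁ v₂)) (hle : H ≤ Omega Q hQ)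
    {h₀ : V ≃ₗ[F] V} (hh₀ : h₀ ∈ H) (hmove : ∀ c : F, h₀ v₁ ≠ c • v₁) : Omega Q hQ ≤ H := by
  have hGO : H ≤ GO Q := fun g hg => (hle hg).1.1
  have htrans : ∀ {z}, Q z = 0 → z ≠ 0 → InPointOrbit H v₁ z := fun hz hz0 =>
    hv.inPointOrbit hQ hS hW hGO hh₀ hmove hz hz0
  have hinv : ∀ (k : V ≃ₗ[F] V) {x y}, k y = x → k⁻¹ x = y := by
    rintro k _ y rfl
    rw [← LinearEquiv.mul_apply, inv_mul_cancel, LinearEquiv.coe_one, id]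
  have hsiegel : ∀ {x u} (hx : Q x = 0) (hxu : polar Q x u = 0), x ≠ 0 → siegel Q hx hxu ∈ H := by
    intro x u hx hxu hx0
    obtain ⟨h, hh, c, hc, e⟩ := htrans hx hx0
    -- A Siegel transformation fixes its centre, so its conjugate by an `h` sending `⟨v₁⟩` to `⟨x⟩`
    -- fixes `v₁` itself and lies in `H` by `hS`.
    have hm : h⁻¹ * siegel Q hx hxu * h ∈ H := by
      refine hS _ (Subgroup.mul_mem _ (Subgroup.mul_mem _ (Subgroup.inv_mem _ (hle hh))
        (siegel_mem_Omega hQ hx hxu)) (hle hh)) ?_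
      rw [LinearEquiv.mul_apply, LinearEquiv.mul_apply, e, map_smul, siegel_apply_center, ← e,
        hinv h rfl]
    have := H.mul_mem (H.mul_mem hh hm) (H.inv_mem hh)
    rwa [show h * (h⁻¹ * siegel Q hx hxu * h) * h⁻¹ = siegel Q hx hxu by group] at this
  have hmap : ∀ {a b}, Q a = 0 → Q b = 0 → polar Q a b = 0 → a ≠ 0 → (∀ c : F, b ≠ c • a) →
      ∃ k ∈ H, k a = b := by
    intro a b ha hb hab ha0 hbc
    obtain ⟨x, hx, hax, hbx⟩ := hQ.exists_singular_polar_eq_one ha hab ha0 hbc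
    have hx0 : x ≠ 0 := by
      rintro rfl
      simp at hax
    rw [polar_comm] at hax hbx
    have hu : polar Q x (b - a) = 0 := by rw [polar_sub_right, hax, hbx, sub_self]
    exact ⟨_, hsiegel hx hu hx0, siegel_sub_apply hx ha hb hax hu⟩
  have hv0 : v₁ ≠ 0 := by
    rintro rfl
    simpa using hv.polar_eq_one
  obtain ⟨w, hw, hw0⟩ := exists_singular_ne_zero_of_two_le_wittIndex hW
  have hw1 := mem_perp.1 w.2
  -- This upgrades transitivity on points to transitivity on vectors. The scaling passes through
  -- `w`, since `hmap` needs independent orthogonal vectors.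
  have hscale : ∀ c : F, c ≠ 0 → ∃ k ∈ H, k v₁ = c • v₁ := by
    intro c hc
    obtain ⟨k, hk, e⟩ := hmap (b := (w : V)) hv.left hw hw1.1 hv0 (hv.coe_ne_smul hw0)
    obtain ⟨k', hk', e'⟩ := hmap (a := c • v₁) (b := w)
      (by rw [QuadraticMap.map_smul, hv.left, smul_zero]) hw
      (by rw [polar_smul_left, hw1.1, smul_zero]) (smul_ne_zero hc hv0)
      fun d => by rw [smul_smul]; exact hv.coe_ne_smul hw0 _
    exact ⟨k'⁻¹ * k, H.mul_mem (H.inv_mem hk') hk, by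
      rw [LinearEquiv.mul_apply, e, hinv k' e']⟩
  intro g hg
  obtain ⟨h, hh, c, hc, e⟩ := htrans (z := g v₁) ((hg.1.1 v₁).trans hv.left)
    ((map_ne_zero_iff g g.injective).2 hv0)
  obtain ⟨k, hk, ek⟩ := hscale c⁻¹ (inv_ne_zero hc)
  have hhk : (h * k) v₁ = g v₁ := by
    rw [LinearEquiv.mul_apply, ek, map_smul, e, smul_smul, inv_mul_cancel₀ hc, one_smul]
  have hm : (h * k)⁻¹ * g ∈ H :=
    hS _ (Subgroup.mul_mem _ (Subgroup.inv_mem _ (hle (H.mul_mem hh hk))) hg)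
      (by rw [LinearEquiv.mul_apply, hinv _ hhk])
  have := H.mul_mem (H.mul_mem hh hk) hm
  rwa [mul_inv_cancel_left] at this

end Orbits

end OrthogonalGroup

/-! ### The stabilisation theorem. -/

theorem mainTheorem9 {F V : Type*} [Field F] [AddCommGroup V] [Module F V] [FiniteDimensional F V]
    (m : ℕ) (hdim : Module.finrank F V = 2 * m + 2)
    (Q : QuadraticForm F V) (hQ : OrthogonalGroup.Nonsingular Q)
    (v₁ v₂ : V) (hv : OrthogonalGroup.IsHyperbolicPair Q v₁ v₂)
    (hW : 2 ≤ OrthogonalGroup.wittIndex (OrthogonalGroup.restr Q v₁ v₂))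
    (H : Subgroup (V ≃ₗ[F] V))
    (hH : OrthogonalGroup.WOmega Q hQ hv ≤ H) (hH' : H < OrthogonalGroup.Omega Q hQ) :
    ∀ h ∈ H, (Submodule.span F {v₁}).map (h : V →ₗ[F] V) = Submodule.span F {v₁} := by
  intro h hh
  by_cases hmove : ∃ c : F, h v₁ = c • v₁
  · obtain ⟨c, hc⟩ := hmove
    have hv0 : v₁ ≠ 0 := by
      rintro rfl
      simpa using hv.polar_eq_one
    have hc0 : c ≠ 0 := by
      rintro rfl
      rw [zero_smul, map_eq_zero_iff h h.injective] at hc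
      exact hv0 hc
    rw [Submodule.map_span, Set.image_singleton, LinearEquiv.coe_coe, hc]
    exact Submodule.span_singleton_smul_eq (IsUnit.mk0 c hc0) v₁
  · push Not at hmove
    exact absurd (hv.Omega_le hQ (fun g hg h1 => hH (hv.mem_WOmega_of_fixes hQ hg h1)) hW hH'.le hh
      hmove) hH'.not_ge
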